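/- **Setting.** A BTB graph $G$ is a finite planar bipartite graph, all of whose black vertices are trivalent, embedded in a cactus (a disk with $n\ge 1$ boundary white vertices $w_1^\partial,\dots,w_n^\partial$, in clockwise order, glued according to a noncrossing partition). We assume that $G$ is minimal: its strands (the zig-zag paths turning maximally left at white and maximally right at black vertices) contain no closed loop, no self-crossing, and no parallel bigon (two strands passing through two distinct edges, both running from the first edge to the second); in particular every component of $G$ meets the boundary. We also assume that the boundary white vertices are not all glued to one another (otherwise $G$ is a single vertex and $\sigma(G)$ below is empty). A TCD map $\mathsf T$ on $G$ sends the white vertices to points of $\mathbb{CP}^d$ such that the three points around each black vertex are distinct and collinear. It is *1-generic* if any three different white vertices on the boundary of a face are sent to points spanning a plane, and consecutive boundary vertices $w_i^\partial,w_{i+1}^\partial$ that are not glued are sent to different points. A hyperplane $H$ is *generic* for $\mathsf T$ if it contains no point of $\mathsf T$. A *VRC* of $\mathsf T$ consists of nonzero lifts $v(w)\in\mathbb C^{d+1}$ of the points $\mathsf T(w)$ and nonzero edge weights $\mu$ with $\sum_{w\sim b}\mu(bw)v(w)=0$ for every black vertex $b$; it is in *affine gauge* with respect to $H$ if some linear form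 with kernel $H$ takes the value $1$ on all $v(w)$. *Projective cluster structure* $\mathrm{pro}(\mathsf T)$. Its quiver has a vertex for each face of $G$ (frozen for boundary faces) and, for each edge of $G$, a dual arrow turning counterclockwise around the black and clockwise around the white endpoint, loops and oriented 2-cycles being deleted. For an internal face $f$ with boundary $b_1,w_1,\dots,b_m,w_m$ in counterclockwise order, $X_f=(-1)^{m+1}\prod_i \mu(b_iw_i)/\mu(b_iw_{i-1})$, for any VRC of $\mathsf T$. *Affine cluster structure* $\mathrm{aff}_H(\mathsf T)$. Its quiver has a vertex for each white vertex of $G$ (frozen for boundary vertices), arrows $u_1\to u_2\to u_3\to u_1$ for each black vertex with neighbours $u_1,u_2,u_3$ in clockwise order, and an arrow $w_{i+1}^\partial\to w_i^\partial$ for each $i$ modulo $n$, loops and oriented 2-cycles being deleted. For an internal white vertex $w$ with adjacent black vertices $b_1,\dots,b_m$, let $w,w_i,w_i'$ be the neighbours of $b_i$ in counterclockwise order; then $Y_w=(-1)^{m+1}\prod_i\mu(b_iw_i')/\mu(b_iw_i)$, for any VRC of $\mathsf T$ in affine gauge with respect to $H$. *Sections.* Place a black vertex $b_{i,i+1}^\partial$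 on each boundary segment between $w_i^\partial$ and $w_{i+1}^\partial$. The star graph has a white vertex $\hat w_b$ for each black vertex $b$ (including the $b_{i,i+1}^\partial$), a black vertex $\hat b_f$ in each face $f$, and an edge $\hat b_f\hat w_b$ whenever $b$ is incident to $f$; if $w_i^\partial,w_{i+1}^\partial$ are glued, the black leaf in the face between them and its neighbour $\hat w_{b_{i,i+1}^\partial}$ are removed. A graph $\sigma(G)$ is obtained by splitting all black vertices of degree greater than $3$ into trees with trivalent black vertices and white vertices of degree two, in any way, and then contracting all black vertices of degree two. Its faces $\hat f_w$ correspond to the white vertices $w$ of $G$. The section $\sigma_H(\mathsf T)$ sends a white vertex $\hat w$ of $\sigma(G)$ to the intersection with $H$ of $\mathsf L(\hat w)=\operatorname{span}\{\mathsf T(w):\hat f_w \text{ is incident to } \hat w\}$. **Theorem.** Let $d\ge2$, let $\mathsf T$ be a 1-generic TCD map to $\mathbb{CP}^d$ on $G$, let $H$ be a hyperplane that is generic for $\mathsf T$, and let $\sigma(G)$ be any graph obtained by the construction above. Then every $\mathsf L(\hat w)$ is a line meeting $H$ in one point, $\sigma_H(\mathsf T)$ is a TCD map to $H\cong\mathbb{CP}^{d-1}$,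 the map $\hat f_w\mapsto w$ is a bijection from the faces of $\sigma(G)$ to the white vertices of $G$, VRCs of $\sigma_H(\mathsf T)$ and VRCs of $\mathsf T$ in affine gauge with respect to $H$ exist, and under this bijection $$\mathrm{pro}(\sigma_H(\mathsf T))=\mathrm{aff}_H(\mathsf T):$$ frozen vertices correspond to frozen vertices, the numbers of arrows agree, and $X_{\hat f_w}=Y_w$ for every internal white vertex $w$ of $G$ (for any VRC of $\sigma_H(\mathsf T)$ and any VRC of $\mathsf T$ in affine gauge with respect to $H$). -/

import Mathlib

open Equiv

/-!
# Planar bipartite graphs in a cactus, TCD maps, sections and their cluster structures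

A bipartite graph embedded in a cactus with boundary vertices `w₁, …, wₙ` (in clockwise order)
is encoded by the standard combinatorial map (rotation system) of the following graph on the
sphere: one extra black vertex `∞` is placed outside the cactus and joined to the boundary white
vertices by `n` additional edges, the *legs*; the leg `i` ends at `wᵢ`. Two boundary vertices are
glued in the cactus exactly when their legs end at the same white vertex, and the noncrossing
condition of a cactus is planarity of the extended graph. The faces of the extended graph are the
faces of the graph in the cactus; the faces around `∞` are the boundary faces.
-/

/-- A bipartite combinatorial map with a marked black vertex `∞`. The darts are the edges of the
extended graph; `rotW` (resp. `rotB`) sends a dart to the next dart in counterclockwise order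
around its white (resp. black) endpoint. `root` is a leg (the one ending at `w₁`). As the boundary
of the disk is numbered clockwise, the legs in counterclockwise order around `∞` are numbered
increasingly: `rotB` sends leg `i` to leg `i + 1`. -/
structure BipartiteMap where
  Dart : Type
  [fintypeDart : Fintype Dart]
  [decEqDart : DecidableEq Dart]
  rotW : Perm Dart
  rotB : Perm Dart
  root : Dart

namespace BipartiteMap

attribute [instance] BipartiteMap.fintypeDart BipartiteMap.decEqDart

variable (G : BipartiteMap)

/-- Walking counterclockwise around a face: if `d` is traversed from black to white with the face
on its left, then `faceRot d` is the next dart that is traversed from black to white. -/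
def faceRot : Perm G.Dart := G.rotB⁻¹ * G.rotW⁻¹

/-- White vertices: cycles of `rotW`. -/
def White : Type := Quotient (Perm.SameCycle.setoid G.rotW)

/-- Black vertices, including `∞`: cycles of `rotB`. -/
def Black : Type := Quotient (Perm.SameCycle.setoid G.rotB)

/-- Faces: cycles of `faceRot`. -/
def Face : Type := Quotient (Perm.SameCycle.setoid G.faceRot)

/-- The white endpoint of a dart. -/
def white (d : G.Dart) : G.White := Quotient.mk (Perm.SameCycle.setoid G.rotW) d

/-- The black endpoint of a dart. -/
def black (d : G.Dart) : G.Black := Quotient.mk (Perm.SameCycle.setoid G.rotB) d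

/-- The face to the left of a dart directed from black to white. The face to the right of `d` is
`G.face (G.rotB⁻¹ d)`. -/
def face (d : G.Dart) : G.Face := Quotient.mk (Perm.SameCycle.setoid G.faceRot) d

/-- The legs are the darts at `∞`; the other darts are the edges of the graph. -/
def IsLeg (d : G.Dart) : Prop := G.rotB.SameCycle G.root d

/-- Boundary white vertices. -/
def IsBoundaryWhite (w : G.White) : Prop := ∃ d, G.IsLeg d ∧ G.white d = w

/-- Boundary faces: the faces around `∞`. -/
def IsBoundaryFace (f : G.Face) : Prop := ∃ d, G.IsLeg d ∧ G.face d = f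

theorem isLeg_rotB_iff (d : G.Dart) : G.IsLeg (G.rotB d) ↔ G.IsLeg d :=
  Perm.sameCycle_apply_right

theorem isLeg_rotB_inv_iff (d : G.Dart) : G.IsLeg (G.rotB⁻¹ d) ↔ G.IsLeg d :=
  Perm.sameCycle_symm_apply_right

/-- The map is connected and drawn on the sphere (Euler's formula). -/
structure IsPlanar : Prop where
  connected : MulAction.IsPretransitive (Subgroup.closure {G.rotW, G.rotB}) G.Dart
  euler : Nat.card G.White + Nat.card G.Black + Nat.card G.Face = Fintype.card G.Dart + 2

/-- Every black vertex other than `∞` has degree three. -/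
def IsTrivalent : Prop := ∀ d, ¬ G.IsLeg d → G.rotB d ≠ d ∧ G.rotB (G.rotB (G.rotB d)) = d

/-- Black-trivalent bipartite (BTB) graphs, all of whose components meet the boundary. -/
structure IsBTB : Prop where
  planar : G.IsPlanar
  trivalent : G.IsTrivalent

/-- One step of a zig-zag path. The state `(d, true)` means that `d` is traversed from black to
white, `(d, false)` that it is traversed from white to black. The path turns maximally left at
white vertices, where it ends if this would make it leave through a leg, and maximally right at
black vertices. -/
def StrandStep : G.Dart × Bool → G.Dart × Bool → Prop
  | (d, true), s => s = (G.rotW⁻¹ d, false) ∧ ¬ G.IsLeg (G.rotW⁻¹ d)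
  | (d, false), s => s = (G.rotB d, true)

/-- `s'` is visited later than `s` by a strand. -/
def StrandReach : G.Dart × Bool → G.Dart × Bool → Prop := Relation.TransGen G.StrandStep

/-- Minimal (reduced) graphs: no closed strand, no strand that crosses itself, and no two strands
through two edges `d ≠ e` that both run from `d` to `e`. The two strands through the edge `d` are
the ones through the states `(d, true)` and `(d, false)`. -/
structure IsMinimal : Prop where
  no_loop : ∀ d k, ¬ G.IsLeg d → ¬ G.StrandReach (d, k) (d, k)
  no_selfCrossing : ∀ d k, ¬ G.IsLeg d → ¬ G.StrandReach (d, k) (d, !k)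
  no_parallelBigon : ∀ d e k l, ¬ G.IsLeg d → ¬ G.IsLeg e → d ≠ e →
    ¬ (G.StrandReach (d, true) (e, k) ∧ G.StrandReach (d, false) (e, l))

section Geometry

variable {V : Type} [AddCommGroup V] [Module ℂ V]

/-- TCD maps: the points at the white neighbours of a black vertex are distinct and lie on a
line. -/
structure IsTCDMap (T : G.White → Projectivization ℂ V) : Prop where
  distinct : ∀ d e, ¬ G.IsLeg d → G.black d = G.black e → d ≠ e → T (G.white d) ≠ T (G.white e)
  collinear : ∀ d, ¬ G.IsLeg d → ∃ L : Submodule ℂ V, Module.finrank ℂ L = 2 ∧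
    ∀ e, G.black d = G.black e → (T (G.white e)).submodule ≤ L

/-- `1`-generic maps: three different white vertices of a face are sent to points that span a
plane, and two consecutive boundary white vertices that are not glued are sent to different
points. -/
structure IsOneGeneric (T : G.White → Projectivization ℂ V) : Prop where
  plane : ∀ d₁ d₂ d₃, G.face d₁ = G.face d₂ → G.face d₂ = G.face d₃ →
    G.white d₁ ≠ G.white d₂ → G.white d₂ ≠ G.white d₃ → G.white d₁ ≠ G.white d₃ →
    Module.finrank ℂ ((T (G.white d₁)).submodule ⊔ (T (G.white d₂)).submodule ⊔
      (T (G.white d₃)).submodule : Submodule ℂ V) = 3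
  boundary : ∀ d, G.IsLeg d → G.white d ≠ G.white (G.rotB d) →
    T (G.white d) ≠ T (G.white (G.rotB d))

/-- A hyperplane, given by its linear subspace `H`, is generic if it contains no point of `T`. -/
def IsGenericHyperplane (T : G.White → Projectivization ℂ V) (H : Submodule ℂ V) : Prop :=
  ∀ w, ¬ (T w).submodule ≤ H

open Classical in
/-- Vector-relation configurations: nonzero vectors at the white vertices and, at each black
vertex other than `∞`, a linear relation with nonzero coefficients among the vectors at its
neighbours. The values of `wt` on legs play no role. -/
structure VRC (V : Type) [AddCommGroup V] [Module ℂ V] where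
  vec : G.White → V
  wt : G.Dart → ℂ
  vec_ne_zero : ∀ w, vec w ≠ 0
  wt_ne_zero : ∀ d, ¬ G.IsLeg d → wt d ≠ 0
  relation : ∀ d, ¬ G.IsLeg d → ∑ e with G.black e = G.black d, wt e • vec (G.white e) = 0

variable {G}

/-- `R` is a vector-relation configuration of the TCD map `T`. -/
def VRC.IsLiftOf (R : G.VRC V) (T : G.White → Projectivization ℂ V) : Prop :=
  ∀ w, Projectivization.mk ℂ (R.vec w) (R.vec_ne_zero w) = T w

/-- Affine gauge with respect to the hyperplane `H`: a linear form that vanishes exactly on `H`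
(the last homogeneous coordinate of a chart with `H` at infinity) is `1` on all the vectors. -/
def VRC.IsAffineGauge (R : G.VRC V) (H : Submodule ℂ V) : Prop :=
  ∃ l : V →ₗ[ℂ] ℂ, LinearMap.ker l = H ∧ ∀ w, l (R.vec w) = 1

open Classical in
/-- In affine gauge the edge weights around each black vertex sum to zero. -/
theorem VRC.IsAffineGauge.sum_wt {R : G.VRC V} {H : Submodule ℂ V} (h : R.IsAffineGauge H)
    (d : G.Dart) (hd : ¬ G.IsLeg d) : ∑ e with G.black e = G.black d, R.wt e = 0 := by
  obtain ⟨l, -, hl⟩ := h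
  simpa [map_sum, hl] using congrArg l (R.relation d hd)

open Classical in
/-- The projective cluster variable of a face with boundary `b₁, w₁, …, bₘ, wₘ` in
counterclockwise order: `(-1)^(m+1) ∏ μ(bᵢ wᵢ) / μ(bᵢ wᵢ₋₁)`. Here `d = bᵢ wᵢ` runs over the darts
with the face on their left, and `rotB d = bᵢ wᵢ₋₁`. -/
noncomputable def VRC.projVar (R : G.VRC V) (f : G.Face) : ℂ :=
  (-1) ^ ((Finset.univ.filter fun d => G.face d = f).card + 1) *
    ∏ d with G.face d = f, R.wt d / R.wt (G.rotB d)

open Classical in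
/-- The affine cluster variable of a white vertex `w` with black neighbours `b₁, …, bₘ`:
`(-1)^(m+1) ∏ μ(bᵢ w'ᵢ) / μ(bᵢ wᵢ)`, where `w, wᵢ, w'ᵢ` are the neighbours of `bᵢ` in
counterclockwise order. Here `d` runs over the edges `bᵢ w`. -/
noncomputable def VRC.affVar (R : G.VRC V) (w : G.White) : ℂ :=
  (-1) ^ ((Finset.univ.filter fun d => G.white d = w).card + 1) *
    ∏ d with G.white d = w, R.wt (G.rotB (G.rotB d)) / R.wt (G.rotB d)

end Geometry

end BipartiteMap

/-- Quivers with frozen vertices, without loops and oriented `2`-cycles. -/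
structure IceQuiver (V : Type) where
  frozen : V → Prop
  arrows : V → V → ℕ
  no_loop : ∀ v, arrows v v = 0
  no_twoCycle : ∀ u v, arrows u v = 0 ∨ arrows v u = 0

/-- The quiver with arrows `src i ⟶ tgt i`, after deletion of loops and oriented `2`-cycles. -/
noncomputable def IceQuiver.ofArrows {V I : Type} (frozen : V → Prop) (src tgt : I → V) :
    IceQuiver V where
  frozen := frozen
  arrows u v := Nat.card {i // src i = u ∧ tgt i = v} - Nat.card {i // src i = v ∧ tgt i = u}
  no_loop v := by simp
  no_twoCycle u v := by omega

namespace BipartiteMap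

variable (G : BipartiteMap)

/-- The projective quiver: one arrow across each edge (legs are not edges of the graph), turning
counterclockwise around the black endpoint, i.e. from the face on the right to the face on the
left of the edge directed from black to white. -/
noncomputable def projQuiver : IceQuiver G.Face :=
  IceQuiver.ofArrows (I := {d : G.Dart // ¬ G.IsLeg d}) G.IsBoundaryFace
    (fun d => G.face (G.rotB⁻¹ d.1)) (fun d => G.face d.1)

/-- The affine quiver: at a black vertex with neighbours `w₁, w₂, w₃` in clockwise order the arrows
`w₁ ⟶ w₂ ⟶ w₃ ⟶ w₁` (the darts that are not legs), and the arrows from the boundary vertex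
`i + 1` to the boundary vertex `i` (the legs, where `rotB⁻¹` goes from leg `i + 1` to leg `i`). -/
noncomputable def affQuiver : IceQuiver G.White :=
  IceQuiver.ofArrows (I := G.Dart) G.IsBoundaryWhite
    (fun d => G.white d) (fun d => G.white (G.rotB⁻¹ d))

end BipartiteMap

/-- A bipartite map whose faces are labelled by `W`. The label of a face is stored at the darts
that have this face on their left. -/
structure LabelledMap (W : Type) extends BipartiteMap where
  label : Dart → W
  label_faceRot : ∀ d, label (toBipartiteMap.faceRot d) = label d

namespace LabelledMap

variable {W : Type}

/-- `N` arises from `M` by removing the darts `x`, `y` and merging the rotations: in both rotations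
of `M`, the darts `x` and `y` are exchanged and then skipped. If `x`, `y` are the two darts at a
vertex of degree two with different neighbours, this is the contraction of that vertex: it
disappears, and its two neighbours are merged into one vertex. The faces keep their labels. -/
def Contracts (M N : LabelledMap W) (x y : M.Dart) : Prop :=
  ∃ i : N.Dart → M.Dart, Function.Injective i ∧ Set.range i = {x, y}ᶜ ∧
    (∀ d, ∃ k, 0 < k ∧ ((M.rotW * swap x y) ^ k) (i d) = i (N.rotW d) ∧
      ∀ j, 0 < j → j < k → ((M.rotW * swap x y) ^ j) (i d) ∈ ({x, y} : Set M.Dart)) ∧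
    (∀ d, ∃ k, 0 < k ∧ ((M.rotB * swap x y) ^ k) (i d) = i (N.rotB d) ∧
      ∀ j, 0 < j → j < k → ((M.rotB * swap x y) ^ j) (i d) ∈ ({x, y} : Set M.Dart)) ∧
    M.IsLeg (i N.root) ∧
    ∀ d, M.label (i d) = N.label d

/-- `N` arises from `M` by contracting a black vertex of degree two. -/
def ContractBlack (M N : LabelledMap W) : Prop :=
  ∃ x y, x ≠ y ∧ ¬ M.IsLeg x ∧ M.rotB x = y ∧ M.rotB y = x ∧ M.white x ≠ M.white y ∧
    M.Contracts N x y

/-- `N` arises from `M` by splitting a black vertex (other than `∞`) of degree greater than three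
into two black vertices of degree at least three, joined by a new white vertex of degree two.
Equivalently, `M` arises from `N` by contracting this white vertex. -/
def SplitBlack (M N : LabelledMap W) : Prop :=
  ∃ x y, x ≠ y ∧ N.rotW x = y ∧ N.rotW y = x ∧ N.black x ≠ N.black y ∧
    (∀ z, z = x ∨ z = y → ¬ N.IsLeg z ∧ N.rotB z ≠ z ∧ N.rotB (N.rotB z) ≠ z) ∧
    N.Contracts M x y

/-- `N` arises from `M` by removing a black leaf together with the boundary white vertex to which
it is attached, when that vertex has no other edge. There `x` is the edge between the two vertices
and `y` is the leg of the white vertex. At least one leg remains. -/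
def PruneLeaf (M N : LabelledMap W) : Prop :=
  ∃ x y, ¬ M.IsLeg x ∧ M.IsLeg y ∧ M.rotB x = x ∧ M.rotB y ≠ y ∧ M.rotW x = y ∧ M.rotW y = x ∧
    M.Contracts N x y

end LabelledMap

namespace BipartiteMap

variable (G : BipartiteMap)

open Classical in
/-- Rotation around the white vertices of the star graph. -/
noncomputable def starRotW : Perm (G.Dart ⊕ {d : G.Dart // G.IsLeg d}) where
  toFun
    | .inl d => if h : G.IsLeg d then .inr ⟨d, h⟩ else .inl (G.rotB d)
    | .inr d => .inl d.1
  invFun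
    | .inl d => if h : G.IsLeg d then .inr ⟨d, h⟩ else .inl (G.rotB⁻¹ d)
    | .inr d => .inl d.1
  left_inv := by
    rintro (d | ⟨d, h⟩)
    · by_cases h : G.IsLeg d
      · simp [h]
      · have h' : ¬ G.IsLeg (G.rotB d) := by rwa [isLeg_rotB_iff]
        simp [h, h']
    · simp [h]
  right_inv := by
    rintro (d | ⟨d, h⟩)
    · by_cases h : G.IsLeg d
      · simp [h]
      · have h' : ¬ G.IsLeg (G.rotB⁻¹ d) := by rwa [isLeg_rotB_inv_iff]
        simp only [h, h', dite_false]
        simp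
    · simp [h]

/-- Rotation around the black vertices of the star graph and around `∞`. -/
def starRotB : Perm (G.Dart ⊕ {d : G.Dart // G.IsLeg d}) :=
  Equiv.sumCongr G.faceRot (G.rotB.subtypePerm fun d => G.isLeg_rotB_iff d)

/-- The combinatorial map of the star graph. It has a white vertex for each black vertex of `G` and
for each boundary segment between consecutive boundary vertices `i`, `i + 1` (the position of the
boundary black vertex placed there), and a black vertex in each face of `G`.
The dart `inl d` is the edge through the corner between `d` and `rotB d`; this corner lies in the
face `G.face d`. If `d` is not a leg, the edge starts at the white vertex replacing the black
endpoint of `d`; if `d` is leg `i`, it starts at the white vertex on the segment between `i` and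
`i + 1`, and `inr d` is the leg that ends there. -/
noncomputable def starMap : BipartiteMap where
  Dart := G.Dart ⊕ {d : G.Dart // G.IsLeg d}
  fintypeDart := Fintype.ofFinite _
  decEqDart := Classical.decEq _
  rotW := G.starRotW
  rotB := G.starRotB
  root := .inr ⟨G.root, Perm.SameCycle.refl _ _⟩

/-- The white vertex of `G` in the face to the left of a dart of the star graph. -/
def starLabel : G.Dart ⊕ {d : G.Dart // G.IsLeg d} → G.White
  | .inl d => G.white d
  | .inr d => G.white (G.rotB d.1)

theorem white_rotW (d : G.Dart) : G.white (G.rotW d) = G.white d :=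
  Quotient.sound (s := Perm.SameCycle.setoid G.rotW)
    (Perm.sameCycle_apply_left.2 (Perm.SameCycle.refl _ _))

/-- The star graph with its faces labelled by the white vertices of `G`. -/
noncomputable def starGraph : LabelledMap G.White where
  toBipartiteMap := G.starMap
  label := G.starLabel
  label_faceRot := by
    intro d
    obtain ⟨d, rfl⟩ : ∃ e, d = (G.starRotW * G.starRotB) e :=
      ⟨(G.starRotW * G.starRotB).symm d, (Equiv.apply_symm_apply _ d).symm⟩
    have h1 : G.starMap.faceRot ((G.starRotW * G.starRotB) d) = d := by
      change (G.starRotB⁻¹ * G.starRotW⁻¹) ((G.starRotW * G.starRotB) d) = d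
      simp
    rw [h1]
    rcases d with d | ⟨d, h⟩
    · have e1 : (G.starRotW * G.starRotB) (.inl d) = G.starRotW (.inl (G.faceRot d)) := rfl
      have e2 : G.rotW (G.rotB (G.faceRot d)) = d := by simp [faceRot]
      have e3 : G.white (G.rotB (G.faceRot d)) = G.white d := by
        rw [← G.white_rotW, e2]
      rw [e1]
      by_cases hl : G.IsLeg (G.faceRot d)
      · have : G.starRotW (.inl (G.faceRot d)) = .inr ⟨G.faceRot d, hl⟩ := by
          simp [starRotW, hl]
        rw [this]
        exact e3.symm
      · have : G.starRotW (.inl (G.faceRot d)) = .inl (G.rotB (G.faceRot d)) := by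
          simp [starRotW, hl]
        rw [this]
        exact e3.symm
    · rfl

/-- `S` is a graph `σ(G)`: starting from the star graph, remove the black leaves coming from glued
consecutive boundary vertices, split all black vertices of degree greater than three, and contract
all black vertices of degree two. The labels give the correspondence between faces of `S` and
white vertices of `G`. -/
def IsSectionGraph (S : LabelledMap G.White) : Prop :=
  ∃ A M, Relation.ReflTransGen LabelledMap.PruneLeaf G.starGraph A ∧
    Relation.ReflTransGen LabelledMap.SplitBlack A M ∧
    Relation.ReflTransGen LabelledMap.ContractBlack M S ∧
    S.IsTrivalent

end BipartiteMap

namespace LabelledMap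

variable {W V : Type} [AddCommGroup V] [Module ℂ V]

/-- The span of the points `T w` over all faces (labelled by `w`) incident to a white vertex. -/
noncomputable def spanAt (S : LabelledMap W) (T : W → Projectivization ℂ V) (s : S.White) : Submodule ℂ V :=
  ⨆ d : {d // S.white d = s}, (T (S.label d.1)).submodule

/-- `t` is the section of `T` with the hyperplane `H`: at each white vertex `s` of `S`, the
subspace `S.spanAt T s` is a line, and it meets `H` in the point `t s`. -/
def IsSectionMap (S : LabelledMap W) (T : W → Projectivization ℂ V) (H : Submodule ℂ V)
    (t : S.White → Projectivization ℂ H) : Prop :=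
  ∀ s, Module.finrank ℂ (S.spanAt T s) = 2 ∧ (t s).submodule.map H.subtype = S.spanAt T s ⊓ H

end LabelledMap

/-! Let `H = ker l`, lift the points to vectors `v w` with `l (v w) = 1`, choose a linear form `m`
separating distinct lifts, and put `z = m ∘ v`. The line through two different lifts `v a`, `v b`
meets `H` in the direction `v a - v b`; dividing by `z a - z b` normalizes it to a vector that
depends only on the line. At a black vertex of σ(G) the differences of the lifts are the sides of a
nondegenerate triangle, which gives collinearity, distinctness and the edge weights of the section.

In affine gauge the weights at a black vertex satisfy `∑ μ = 0` and `∑ μ z = 0`, so `Y_w` is minus a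
quotient of products of factors `z w - z w'`. The variable `X` of the face labelled `w` has the same
shape, as the rescaling of a VRC cancels around a face. In both cases the factors are indexed by the
arrows at `w`, those into `w` above and those out of `w` below, so the value depends only on the
signed arrow counts (`prod_div_prod_eq`). Equality of variables therefore follows from equality of
quivers.

For the star graph the quivers agree arrow by arrow: the edge through a corner of `G` separates the
two white vertices next to that corner (`starGraph_hasDualQuiver`). Pruning, splitting and
contracting remove or insert two darts without changing the set of faces, and the affected arrows
form a loop or an opposite pair (`Reduces`). Genericity is carried along (`Compatible`,
`Separated`): labels at a black vertex have independent lifts, and consecutive labels around a white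
vertex have different `z`.

The independence for the star graph rests on minimality: a face visits each white vertex at most
once (`IsMinimal.eq_of_face_eq_of_white_eq`). Otherwise, cutting that white vertex in two would
raise the numbers of vertices and faces; by Euler's formula the map falls apart, and the part
without the boundary traps a strand. -/

theorem perm_inv_apply_self {D : Type} (σ : Perm D) (d : D) : σ⁻¹ (σ d) = d :=
  σ.symm_apply_apply d

theorem perm_apply_inv_self {D : Type} (σ : Perm D) (d : D) : σ (σ⁻¹ d) = d :=
  σ.apply_symm_apply d

/-! ### Cycles of permutations and the genus inequality -/

/-- The cycles of a permutation, fixed points included. -/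
abbrev CycleQuot {D : Type} (σ : Perm D) : Type := Quotient (Perm.SameCycle.setoid σ)

/-- The cycle through a point. -/
abbrev cycleMk {D : Type} (σ : Perm D) (d : D) : CycleQuot σ :=
  Quotient.mk (Perm.SameCycle.setoid σ) d

theorem cycleMk_eq {D : Type} {σ : Perm D} {d e : D} :
    cycleMk σ d = cycleMk σ e ↔ σ.SameCycle d e := Quotient.eq (r := Perm.SameCycle.setoid σ)

theorem cycleMk_apply {D : Type} (σ : Perm D) (d : D) : cycleMk σ (σ d) = cycleMk σ d :=
  cycleMk_eq.2 (Perm.sameCycle_apply_left.2 (Perm.SameCycle.refl _ _))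

/-- Two permutations act transitively if no proper nonempty set is invariant under both. -/
def JointlyTransitive {D : Type} (σ τ : Perm D) : Prop :=
  ∀ s : Set D, s.Nonempty → (∀ d, σ d ∈ s ↔ d ∈ s) → (∀ d, τ d ∈ s ↔ d ∈ s) → s = Set.univ

theorem finrank_le_one_of_forall_mem_span {E : Type} [AddCommGroup E] [Module ℚ E]
    {K : Submodule ℚ E} {x : E} (h : ∀ y ∈ K, y ∈ Submodule.span ℚ {x}) :
    Module.finrank ℚ K ≤ 1 :=
  (Submodule.finrank_mono (show K ≤ Submodule.span ℚ {x} from h)).trans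
    ((finrank_span_le_card ({x} : Set E)).trans (by simp))

/-- The genus of a transitive combinatorial map is nonnegative. -/
theorem card_cycles_le {D : Type} [Fintype D] [Nonempty D] {σ τ : Perm D}
    (h : JointlyTransitive σ τ) :
    Nat.card (CycleQuot σ) + Nat.card (CycleQuot τ) + Nat.card (CycleQuot (σ * τ)) ≤
      Fintype.card D + 2 := by
  classical
  obtain ⟨d₀⟩ := ‹Nonempty D›
  have key : ∀ d, cycleMk (σ * τ) (σ d) = cycleMk (σ * τ) (τ⁻¹ d) := fun d => by
    have := cycleMk_apply (σ * τ) (τ⁻¹ d)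
    simpa using this
  -- `δ` is the coboundary from the vertices, `ε` the one from the faces. By transitivity their
  -- kernels consist of constants only. Their images are orthogonal, so the ranks, at least `V - 1`
  -- and `F - 1`, add up to at most the number of darts.
  let δ : ((CycleQuot σ → ℚ) × (CycleQuot τ → ℚ)) →ₗ[ℚ] (D → ℚ) :=
    { toFun := fun p d => p.1 (cycleMk σ d) - p.2 (cycleMk τ d)
      map_add' := fun p q => by ext d; simp; ring
      map_smul' := fun c p => by ext d; simp; ring }
  let ε : (CycleQuot (σ * τ) → ℚ) →ₗ[ℚ] (D → ℚ) :=
    { toFun := fun k d => k (cycleMk (σ * τ) d) - k (cycleMk (σ * τ) (σ d))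
      map_add' := fun p q => by ext d; simp; ring
      map_smul' := fun c p => by ext d; simp; ring }
  have hδ : Module.finrank ℚ (LinearMap.ker δ) ≤ 1 := by
    refine finrank_le_one_of_forall_mem_span (x := (1, 1)) ?_
    rintro ⟨f, g⟩ hfg
    have hfg' : ∀ d, f (cycleMk σ d) = g (cycleMk τ d) := fun d =>
      sub_eq_zero.1 (congrFun (LinearMap.mem_ker.1 hfg) d)
    have hs := h {d | f (cycleMk σ d) = f (cycleMk σ d₀)} ⟨d₀, rfl⟩
      (fun d => by simp only [Set.mem_ofPred_eq, cycleMk_apply])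
      (fun d => by simp only [Set.mem_ofPred_eq, hfg', cycleMk_apply])
    rw [Set.eq_univ_iff_forall] at hs
    refine Submodule.mem_span_singleton.2 ⟨f (cycleMk σ d₀), ?_⟩
    refine Prod.ext (funext fun q => ?_) (funext fun q => ?_)
    · induction q using Quotient.inductionOn with | h d => simpa using (hs d).symm
    · induction q using Quotient.inductionOn with
      | h d => simpa using (hs d).symm.trans (hfg' d)
  have hε : Module.finrank ℚ (LinearMap.ker ε) ≤ 1 := by
    refine finrank_le_one_of_forall_mem_span (x := 1) ?_
    intro k hk
    have hk' : ∀ d, k (cycleMk (σ * τ) (σ d)) = k (cycleMk (σ * τ) d) := fun d =>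
      (sub_eq_zero.1 (congrFun (LinearMap.mem_ker.1 hk) d)).symm
    have hk'' : ∀ d, k (cycleMk (σ * τ) (τ d)) = k (cycleMk (σ * τ) d) := fun d => by
      have := hk' (τ d)
      rw [key, perm_inv_apply_self] at this
      exact this.symm
    have hs := h {d | k (cycleMk (σ * τ) d) = k (cycleMk (σ * τ) d₀)} ⟨d₀, rfl⟩
      (fun d => by simp only [Set.mem_ofPred_eq, hk']) (fun d => by simp only [Set.mem_ofPred_eq, hk''])
    rw [Set.eq_univ_iff_forall] at hs
    refine Submodule.mem_span_singleton.2 ⟨k (cycleMk (σ * τ) d₀), funext fun q => ?_⟩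
    induction q using Quotient.inductionOn with | h d => simpa using (hs d).symm
  have horth : ∀ p k, ∑ d, δ p d * ε k d = 0 := by
    intro p k
    have e1 : ∑ d, p.1 (cycleMk σ d) * k (cycleMk (σ * τ) (σ d)) =
        ∑ d, p.1 (cycleMk σ d) * k (cycleMk (σ * τ) d) := by
      rw [← Equiv.sum_comp σ (fun d => p.1 (cycleMk σ d) * k (cycleMk (σ * τ) d))]
      simp only [cycleMk_apply]
    have e2 : ∑ d, p.2 (cycleMk τ d) * k (cycleMk (σ * τ) (σ d)) =
        ∑ d, p.2 (cycleMk τ d) * k (cycleMk (σ * τ) d) := by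
      simp only [key]
      rw [← Equiv.sum_comp τ (fun d => p.2 (cycleMk τ d) * k (cycleMk (σ * τ) (τ⁻¹ d)))]
      simp only [cycleMk_apply, perm_inv_apply_self]
    have : ∀ d, δ p d * ε k d = p.1 (cycleMk σ d) * k (cycleMk (σ * τ) d) -
        p.1 (cycleMk σ d) * k (cycleMk (σ * τ) (σ d)) -
        (p.2 (cycleMk τ d) * k (cycleMk (σ * τ) d) -
        p.2 (cycleMk τ d) * k (cycleMk (σ * τ) (σ d))) := fun d => by
      change (p.1 _ - p.2 _) * (k _ - k _) = _
      ring
    simp only [this, Finset.sum_sub_distrib, e1, e2, sub_self]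
  -- A common element of the two images is orthogonal to itself, hence zero over `ℚ`.
  have hdisj : Disjoint (LinearMap.range δ) (LinearMap.range ε) := by
    rw [Submodule.disjoint_def]
    rintro _ ⟨p, rfl⟩ ⟨k, hk⟩
    have h0 := horth p k
    rw [hk] at h0
    funext d
    have := (Finset.sum_eq_zero_iff_of_nonneg fun d _ => mul_self_nonneg (δ p d)).1 h0 d
      (Finset.mem_univ d)
    simpa using this
  have h1 := Submodule.finrank_add_finrank_le_of_disjoint hdisj
  have h2 := LinearMap.finrank_range_add_finrank_ker δ
  have h3 := LinearMap.finrank_range_add_finrank_ker ε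
  have : Fintype (CycleQuot σ) := Fintype.ofFinite _
  have : Fintype (CycleQuot τ) := Fintype.ofFinite _
  have : Fintype (CycleQuot (σ * τ)) := Fintype.ofFinite _
  simp only [Module.finrank_prod, Module.finrank_fintype_fun_eq_card] at h1 h2 h3
  simp only [Nat.card_eq_fintype_card]
  omega

/-- Multiplication by the transposition of two points of a cycle separates them. -/
theorem not_sameCycle_swap_mul {D : Type} [Fintype D] [DecidableEq D] {σ : Perm D} {a b : D}
    (hab : a ≠ b) (h : σ.SameCycle a b) : ¬ (swap a b * σ).SameCycle a b := by
  classical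
  have hex : ∃ k : ℕ, (σ ^ k) a = b := h.exists_nat_pow_eq
  let k := Nat.find hex
  have hk : (σ ^ k) a = b := Nat.find_spec hex
  have hmin : ∀ j < k, (σ ^ j) a ≠ b := fun j hj => Nat.find_min hex hj
  have hk0 : 0 < k := Nat.pos_of_ne_zero fun h0 => hab (by simpa [h0] using hk)
  -- The new orbit of `a` stays on the arc from `a` to the point before `b`: where `σ` would reach
  -- `b`, the transposition sends it back to `a`.
  have hmem : ∀ n : ℕ, ∃ j < k, ((swap a b * σ) ^ n) a = (σ ^ j) a := by
    intro n
    induction n with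
    | zero => exact ⟨0, hk0, by simp⟩
    | succ n ih =>
      obtain ⟨j, hj, hn⟩ := ih
      have e : ((swap a b * σ) ^ (n + 1)) a = swap a b ((σ ^ (j + 1)) a) := by
        rw [pow_succ', pow_succ', Perm.mul_apply, hn, Perm.mul_apply, Perm.mul_apply]
      by_cases hjk : j + 1 = k
      · exact ⟨0, hk0, by rw [e, hjk, hk, swap_apply_right]; simp⟩
      · refine ⟨j + 1, by omega, ?_⟩
        rw [e, swap_apply_of_ne_of_ne _ (hmin _ (by omega))]
        intro h1
        refine hmin (k - (j + 1)) (by omega) ?_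
        rw [← hk]
        nth_rw 2 [show k = (k - (j + 1)) + (j + 1) by omega]
        rw [pow_add, Perm.mul_apply, h1]
  intro hs
  obtain ⟨n, hn⟩ := hs.exists_nat_pow_eq
  obtain ⟨j, hj, hjn⟩ := hmem n
  exact hmin j hj (hjn ▸ hn)

/-- The cycles of `swap a b * σ` refine those of `σ`, and the refinement is proper because the cycle
through `a` and `b` is cut. -/
theorem card_cycles_lt_swap_mul {D : Type} [Fintype D] [DecidableEq D] {σ : Perm D} {a b : D}
    (hab : a ≠ b) (h : σ.SameCycle a b) :
    Nat.card (CycleQuot σ) < Nat.card (CycleQuot (swap a b * σ)) := by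
  have step : ∀ d, cycleMk σ ((swap a b * σ) d) = cycleMk σ d := by
    intro d
    rw [Perm.mul_apply]
    by_cases h1 : σ d = a
    · rw [h1, swap_apply_left, ← cycleMk_eq.2 h, ← h1, cycleMk_apply]
    by_cases h2 : σ d = b
    · rw [h2, swap_apply_right, cycleMk_eq.2 h, ← h2, cycleMk_apply]
    rw [swap_apply_of_ne_of_ne h1 h2, cycleMk_apply]
  have hiter : ∀ (n : ℕ) d, cycleMk σ (((swap a b * σ) ^ n) d) = cycleMk σ d := by
    intro n d
    induction n with
    | zero => rfl
    | succ n ih => rw [pow_succ', Perm.mul_apply, step, ih]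
  let π : CycleQuot (swap a b * σ) → CycleQuot σ := Quotient.lift (cycleMk σ) (by
    intro d e hde
    obtain ⟨n, rfl⟩ := Perm.SameCycle.exists_nat_pow_eq (show (swap a b * σ).SameCycle d e from hde)
    exact (hiter n d).symm)
  have hsurj : Function.Surjective π := fun q => by
    induction q using Quotient.inductionOn with | h d => exact ⟨cycleMk _ d, rfl⟩
  have : Finite (CycleQuot (swap a b * σ)) := Quotient.finite _
  refine lt_of_le_of_ne (Nat.card_le_card_of_surjective π hsurj) fun hcard => ?_
  have hbij : Function.Bijective π :=
    (Nat.bijective_iff_surjective_and_card π).2 ⟨hsurj, hcard.symm⟩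
  exact not_sameCycle_swap_mul hab h (cycleMk_eq.1 (hbij.1 (cycleMk_eq.2 h)))

/-! ### Faces of minimal graphs -/

namespace BipartiteMap

variable {G : BipartiteMap}

theorem white_eq {d e : G.Dart} : G.white d = G.white e ↔ G.rotW.SameCycle d e := cycleMk_eq

theorem black_eq {d e : G.Dart} : G.black d = G.black e ↔ G.rotB.SameCycle d e := cycleMk_eq

theorem face_eq {d e : G.Dart} : G.face d = G.face e ↔ G.faceRot.SameCycle d e := cycleMk_eq

theorem faceRot_eq_inv : G.faceRot = (G.rotW * G.rotB)⁻¹ := by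
  rw [mul_inv_rev]; rfl

theorem sameCycle_faceRot_iff {d e : G.Dart} :
    G.faceRot.SameCycle d e ↔ (G.rotW * G.rotB).SameCycle d e := by
  rw [faceRot_eq_inv, Perm.sameCycle_inv]

theorem IsPlanar.jointlyTransitive (h : G.IsPlanar) : JointlyTransitive G.rotW G.rotB := by
  intro s ⟨d, hd⟩ hW hB
  have hcl : ∀ g ∈ Subgroup.closure {G.rotW, G.rotB}, ∀ e, g e ∈ s ↔ e ∈ s := by
    intro g hg
    induction hg using Subgroup.closure_induction with
    | mem x hx => rcases hx with rfl | rfl <;> assumption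
    | one => intro e; rfl
    | mul x y _ _ hx hy => intro e; rw [Perm.mul_apply, hx, hy]
    | inv x _ hx => intro e; rw [← hx (x⁻¹ e), perm_apply_inv_self]
  refine Set.eq_univ_of_forall fun e => ?_
  obtain ⟨⟨g, hg⟩, rfl⟩ := h.connected.exists_smul_eq d e
  exact (hcl g hg d).2 hd

/-- The strand permutation: zig-zag paths, ignoring that they end at the boundary. -/
def zigzag (G : BipartiteMap) : Perm (G.Dart × Bool) where
  toFun
    | (d, true) => (G.rotW⁻¹ d, false)
    | (d, false) => (G.rotB d, true)
  invFun
    | (d, false) => (G.rotW d, true)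
    | (d, true) => (G.rotB⁻¹ d, false)
  left_inv := by rintro ⟨d, _ | _⟩ <;> simp
  right_inv := by rintro ⟨d, _ | _⟩ <;> simp

/-- In a minimal graph no part is attached to the rest only in one corner of a white vertex. -/
theorem IsMinimal.false_of_isolated (h : G.IsMinimal) {P : Set G.Dart} {a : G.Dart} (ha : a ∈ P)
    (hleg : ∀ d ∈ P, ¬ G.IsLeg d) (hB : ∀ d ∈ P, G.rotB d ∈ P)
    (hW : ∀ d ∈ P, d ≠ a → G.rotW⁻¹ d ∈ P) : False := by
  -- The strand starting in `(a, false)` stays in `P`: it could leave only by turning left out of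
  -- `(a, true)`, and reaching that state would be a self-crossing. As `zigzag` has finite order,
  -- the strand closes up, which is excluded too.
  have key : ∀ n : ℕ, (((G.zigzag) ^ (n + 1)) (a, false)).1 ∈ P ∧
      G.StrandReach (a, false) ((G.zigzag ^ (n + 1)) (a, false)) := by
    intro n
    induction n with
    | zero => exact ⟨hB a ha, Relation.TransGen.single rfl⟩
    | succ n ih =>
      rw [pow_succ', Perm.mul_apply]
      obtain ⟨h1, h2⟩ := ih
      obtain ⟨⟨e, k⟩, he⟩ : ∃ s, s = (G.zigzag ^ (n + 1)) (a, false) := ⟨_, rfl⟩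
      rw [← he] at h1 h2 ⊢
      cases k with
      | false => exact ⟨hB e h1, h2.tail rfl⟩
      | true =>
        have hne : e ≠ a := by
          rintro rfl
          exact h.no_selfCrossing e false (hleg e ha) h2
        exact ⟨hW e h1 hne, h2.tail ⟨rfl, hleg _ (hW e h1 hne)⟩⟩
  have := (key (orderOf G.zigzag - 1)).2
  rw [Nat.sub_add_cancel (orderOf_pos _), pow_orderOf_eq_one] at this
  exact h.no_loop a false (hleg a ha) this

/-- A face of a minimal graph visits each white vertex at most once. -/
theorem IsMinimal.eq_of_face_eq_of_white_eq (hmin : G.IsMinimal) (hG : G.IsPlanar) {a b : G.Dart}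
    (hf : G.face a = G.face b) (hw : G.white a = G.white b) : a = b := by
  by_contra hab
  rw [white_eq] at hw
  rw [face_eq, sameCycle_faceRot_iff] at hf
  have : Nonempty G.Dart := ⟨a⟩
  -- The transposition cuts the white vertex of `a` and `b`, and also their face, since `(swap a b *
  -- rotW) * rotB = swap a b * (rotW * rotB)`. Two more cycles than Euler's formula allows for a
  -- transitive map.
  have hnt : ¬ JointlyTransitive (swap a b * G.rotW) G.rotB := by
    intro ht
    have h1 := card_cycles_le ht
    have h2 := card_cycles_lt_swap_mul hab hw
    have h3 := card_cycles_lt_swap_mul hab hf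
    have h4 := hG.euler
    have h5 : Nat.card G.Face = Nat.card (CycleQuot (G.rotW * G.rotB)) :=
      Nat.card_congr (Quotient.congrRight fun d e => sameCycle_faceRot_iff)
    rw [h5] at h4
    change Nat.card (CycleQuot _) + Nat.card (CycleQuot _) + _ = _ at h4
    rw [mul_assoc] at h1
    omega
  obtain ⟨P, hroot, hne, hW, hB⟩ : ∃ P : Set G.Dart, G.root ∉ P ∧ P.Nonempty ∧
      (∀ d, (swap a b * G.rotW) d ∈ P ↔ d ∈ P) ∧ ∀ d, G.rotB d ∈ P ↔ d ∈ P := by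
    unfold JointlyTransitive at hnt
    push Not at hnt
    obtain ⟨s, hs, hW, hB, hu⟩ := hnt
    by_cases hr : G.root ∈ s
    · refine ⟨sᶜ, by simpa using hr, Set.nonempty_compl.2 hu, fun d => ?_, fun d => ?_⟩
      · exact not_congr (hW d)
      · exact not_congr (hB d)
    · exact ⟨s, hr, hs, hW, hB⟩
  -- If `P` did not separate `a` from `b`, it would be invariant under the original `rotW`,
  -- contradicting connectedness.
  have hiff : ¬ (a ∈ P ↔ b ∈ P) := by
    intro hiff
    have hsw : ∀ d, swap a b d ∈ P ↔ d ∈ P := by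
      intro d
      rw [swap_apply_def]
      split_ifs with h1 h2
      · rw [h1, hiff]
      · rw [h2, hiff]
      · rfl
    have := hG.jointlyTransitive P hne (fun d => by rw [← hW d, Perm.mul_apply, hsw]) hB
    exact hroot (this ▸ Set.mem_univ _)
  have hleg : ∀ d ∈ P, ¬ G.IsLeg d := by
    intro d hd hl
    obtain ⟨n, rfl⟩ := Perm.SameCycle.exists_nat_pow_eq hl
    refine hroot ?_
    clear hl
    induction n with
    | zero => exact hd
    | succ n ih => exact ih ((hB _).1 (by rwa [pow_succ', Perm.mul_apply] at hd))
  -- `c` stands for whichever of `a`, `b` lies in `P`; the transposition fixes every other dart of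
  -- `P`, so the strand can escape only at `c`.
  have main : ∀ c ∈ P, (∀ d ∈ P, d ≠ c → swap a b d = d) → False := by
    intro c hc hsw
    refine hmin.false_of_isolated hc hleg (fun d hd => (hB d).2 hd) fun d hd hdc => ?_
    rw [← hW, Perm.mul_apply, perm_apply_inv_self, hsw d hd hdc]
    exact hd
  by_cases ha : a ∈ P
  · have hb : b ∉ P := fun hb => hiff (by simp [ha, hb])
    exact main a ha fun d hd hda => swap_apply_of_ne_of_ne hda (by rintro rfl; exact hb hd)
  · have hb : b ∈ P := by_contra fun hb => hiff (by simp [ha, hb])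
    exact main b hb fun d hd hdb => swap_apply_of_ne_of_ne (by rintro rfl; exact ha hd) hdb

end BipartiteMap

/-! ### First returns: deleting points from the cycles of a permutation -/

/-- `e` is the first point outside `S` that is reached from `a` by iterating `ρ` at least once. -/
def FirstReturn {D : Type} (ρ : Perm D) (S : Set D) (a e : D) : Prop :=
  ∃ k, 0 < k ∧ (ρ ^ k) a = e ∧ ∀ j, 0 < j → j < k → (ρ ^ j) a ∈ S

namespace FirstReturn

variable {D E : Type} {ρ : Perm D} {S : Set D} {a e : D}

theorem single (h : ρ a = e) : FirstReturn ρ S a e :=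
  ⟨1, one_pos, by simpa using h, fun j h1 h2 => by omega⟩

theorem head (ha : ρ a ∈ S) (h : FirstReturn ρ S (ρ a) e) : FirstReturn ρ S a e := by
  obtain ⟨k, hk, h1, h2⟩ := h
  refine ⟨k + 1, by omega, by rw [pow_succ, Perm.mul_apply, h1], fun j hj hjk => ?_⟩
  obtain ⟨j, rfl⟩ := Nat.exists_eq_succ_of_ne_zero hj.ne'
  rcases Nat.eq_zero_or_pos j with rfl | hj'
  · simpa using ha
  · rw [pow_succ, Perm.mul_apply]
    exact h2 j hj' (by omega)

theorem eq_of_notMem (h : FirstReturn ρ S a e) (ha : ρ a ∉ S) : e = ρ a := by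
  obtain ⟨k, hk, h1, h2⟩ := h
  rcases Nat.lt_or_ge 1 k with hk1 | hk1
  · exact absurd (by simpa using h2 1 one_pos hk1) ha
  · obtain rfl : k = 1 := by omega
    simpa using h1.symm

theorem tail (h : FirstReturn ρ S a e) (ha : ρ a ∈ S) (he : e ∉ S) :
    FirstReturn ρ S (ρ a) e := by
  obtain ⟨k, hk, h1, h2⟩ := h
  rcases Nat.lt_or_ge 1 k with hk1 | hk1
  · obtain ⟨k, rfl⟩ := Nat.exists_eq_succ_of_ne_zero hk.ne'
    refine ⟨k, by omega, by rw [← h1, pow_succ, Perm.mul_apply], fun j hj hjk => ?_⟩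
    have := h2 (j + 1) (by omega) (by omega)
    rwa [pow_succ, Perm.mul_apply] at this
  · obtain rfl : k = 1 := by omega
    rw [pow_one] at h1
    exact absurd (h1 ▸ ha) he

/-- A `ρ`-orbit meets the image of `i` in the order prescribed by `τ`, so deleting the points of `S`
neither joins nor separates the remaining ones. The induction is on the length of the `ρ`-walk,
shortened by one return at a time. -/
theorem sameCycle_iff [Finite D] [Finite E] {τ : Perm E} {i : E → D} (hi : Function.Injective i)
    (hS : ∀ d, i d ∉ S) (h : ∀ d, FirstReturn ρ S (i d) (i (τ d))) (d d' : E) :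
    ρ.SameCycle (i d) (i d') ↔ τ.SameCycle d d' := by
  constructor
  · intro hc
    obtain ⟨n, hn⟩ := hc.exists_nat_pow_eq
    clear hc
    induction n using Nat.strong_induction_on generalizing d with
    | _ n ih =>
      rcases Nat.eq_zero_or_pos n with rfl | hn0
      · obtain rfl : d = d' := hi (by simpa using hn)
        exact Perm.SameCycle.refl _ _
      · obtain ⟨k, hk, h1, h2⟩ := h d
        have hkn : k ≤ n := by
          by_contra hlt
          exact hS d' (hn ▸ h2 n hn0 (by omega))
        rw [← Perm.sameCycle_apply_left]
        refine ih (n - k) (by omega) (τ d) ?_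
        rw [← h1, ← Perm.mul_apply, ← pow_add, Nat.sub_add_cancel hkn, hn]
  · intro hc
    obtain ⟨n, rfl⟩ := hc.exists_nat_pow_eq
    clear hc
    induction n with
    | zero => exact Perm.SameCycle.refl _ _
    | succ n ih =>
      obtain ⟨k, hk, h1, h2⟩ := h ((τ ^ n) d)
      rw [pow_succ', Perm.mul_apply, ← h1]
      exact Perm.sameCycle_pow_right.2 ih

end FirstReturn

/-! ### The local moves and their effect on faces -/

namespace LabelledMap

variable {W : Type} {M N : LabelledMap W}

/-- `rotB⁻¹ d` has the face to the right of `d` on its left, so `label (rotW d)` serves throughout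
as the label on the right of `d`. -/
theorem label_rotW (M : LabelledMap W) (d : M.Dart) :
    M.label (M.rotW d) = M.label (M.rotB⁻¹ d) := by
  rw [← M.label_faceRot (M.rotW d)]
  congr 1
  rw [BipartiteMap.faceRot, Perm.mul_apply, perm_inv_apply_self]

theorem label_rotW_rotB (M : LabelledMap W) (d : M.Dart) :
    M.label (M.rotW (M.rotB d)) = M.label d := by
  rw [label_rotW, perm_inv_apply_self]

theorem label_eq_of_face_eq {e e' : M.Dart} (h : M.face e = M.face e') :
    M.label e = M.label e' := by
  obtain ⟨n, rfl⟩ := (BipartiteMap.face_eq.1 h).exists_nat_pow_eq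
  clear h
  induction n with
  | zero => rfl
  | succ n ih => rw [pow_succ', Perm.mul_apply, M.label_faceRot, ← ih]

/-- `N` arises from `M` by removing the darts `x`, `y` in such a way that the faces and their
incidences, up to cancelling arrows of the dual quiver, do not change. -/
structure Reduces (M N : LabelledMap W) (x y : M.Dart) (i : N.Dart → M.Dart) : Prop where
  ne : x ≠ y
  injective : Function.Injective i
  ne_left : ∀ d, i d ≠ x
  ne_right : ∀ d, i d ≠ y
  cover : ∀ e, e = x ∨ e = y ∨ ∃ d, i d = e
  label_eq : ∀ d, M.label (i d) = N.label d
  label_rotW_eq : ∀ d, M.label (M.rotW (i d)) = N.label (N.rotW d)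
  isLeg_iff : ∀ d, M.IsLeg (i d) ↔ N.IsLeg d
  face_iff : ∀ d d', M.face (i d) = M.face (i d') ↔ N.face d = N.face d'
  exists_face_eq : ∀ e, ∃ d, M.face e = M.face (i d)
  exists_leg : ∀ e, M.IsLeg e → ∃ d, N.IsLeg d ∧ N.label d = M.label e
  cancel : ¬ M.IsLeg x ∧
    (¬ M.IsLeg y ∧ M.label (M.rotW x) = M.label y ∧ M.label (M.rotW y) = M.label x ∨
      M.IsLeg y ∧ M.label (M.rotW x) = M.label x)

theorem face_rotW_rotB (M : LabelledMap W) (e : M.Dart) :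
    M.face (M.rotW (M.rotB e)) = M.face e := by
  rw [BipartiteMap.face_eq, BipartiteMap.sameCycle_faceRot_iff]
  exact Perm.sameCycle_apply_left.2 (Perm.SameCycle.refl _ _)

theorem cover_of_range {x y : M.Dart} {i : N.Dart → M.Dart} (h : Set.range i = {x, y}ᶜ) :
    (∀ d, i d ∉ ({x, y} : Set M.Dart)) ∧ (∀ d, i d ≠ x) ∧ (∀ d, i d ≠ y) ∧
      (∀ e, e = x ∨ e = y ∨ ∃ d, i d = e) ∧ ∀ e, e ≠ x → e ≠ y → ∃ d, i d = e := by
  have h1 : ∀ d, i d ∉ ({x, y} : Set M.Dart) := fun d hd => by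
    have : i d ∈ Set.range i := ⟨d, rfl⟩
    rw [h] at this
    exact this hd
  have h2 : ∀ e, e ≠ x → e ≠ y → ∃ d, i d = e := fun e hx hy => by
    have : e ∈ Set.range i := by
      rw [h]
      simp [hx, hy]
    exact this
  refine ⟨h1, fun d hd => h1 d (by simp [hd]), fun d hd => h1 d (by simp [hd]), fun e => ?_, h2⟩
  by_cases hx : e = x
  · exact .inl hx
  · by_cases hy : e = y
    · exact .inr (.inl hy)
    · exact .inr (.inr (h2 e hx hy))

theorem mul_swap_apply {D : Type} [DecidableEq D] (σ : Perm D) {x y d : D} (hx : d ≠ x)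
    (hy : d ≠ y) : (σ * swap x y) d = σ d := by
  rw [Perm.mul_apply, swap_apply_of_ne_of_ne hx hy]

theorem mul_swap_apply_left {D : Type} [DecidableEq D] (σ : Perm D) (x y : D) :
    (σ * swap x y) x = σ y := by
  rw [Perm.mul_apply, swap_apply_left]

theorem mul_swap_apply_right {D : Type} [DecidableEq D] (σ : Perm D) (x y : D) :
    (σ * swap x y) y = σ x := by
  rw [Perm.mul_apply, swap_apply_right]

/-- If `σ` exchanges `x` and `y`, then removing them does not affect the other darts. -/
theorem firstReturn_exchange {D : Type} [DecidableEq D] {σ : Perm D} {x y a e : D}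
    (hxy : σ x = y) (hyx : σ y = x) (hx : a ≠ x) (hy : a ≠ y)
    (h : FirstReturn (σ * swap x y) {x, y} a e) : e = σ a := by
  have h1 : (σ * swap x y) a = σ a := mul_swap_apply σ hx hy
  rw [← h1]
  refine h.eq_of_notMem ?_
  rw [h1]
  rintro (h2 | h2)
  · exact hy (σ.injective (h2.trans hyx.symm))
  · exact hx (σ.injective (h2.trans hxy.symm))

/-- Removing `x` and `y` merges the rotations at two different vertices. -/
theorem firstReturn_merge {D : Type} [DecidableEq D] {σ : Perm D} {x y a e : D}
    (hx : a ≠ x) (hy : a ≠ y) (hex : e ≠ x) (hey : e ≠ y)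
    (hσx : σ x ≠ x ∧ σ x ≠ y) (hσy : σ y ≠ x ∧ σ y ≠ y)
    (h : FirstReturn (σ * swap x y) {x, y} a e) :
    e = σ a ∧ σ a ≠ x ∧ σ a ≠ y ∨ σ a = x ∧ e = σ y ∨ σ a = y ∧ e = σ x := by
  have h1 : (σ * swap x y) a = σ a := mul_swap_apply σ hx hy
  have he : e ∉ ({x, y} : Set D) := by simp [hex, hey]
  by_cases hax : σ a = x
  · refine .inr (.inl ⟨hax, ?_⟩)
    have h2 := h.tail (by simp [h1, hax]) he
    rw [h1, hax] at h2
    rw [← mul_swap_apply_left σ x y]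
    exact h2.eq_of_notMem (by rw [mul_swap_apply_left]; simp [hσy])
  by_cases hay : σ a = y
  · refine .inr (.inr ⟨hay, ?_⟩)
    have h2 := h.tail (by simp [h1, hay]) he
    rw [h1, hay] at h2
    rw [← mul_swap_apply_right σ x y]
    exact h2.eq_of_notMem (by rw [mul_swap_apply_right]; simp [hσx])
  · refine .inl ⟨?_, hax, hay⟩
    rw [← h1]
    exact h.eq_of_notMem (by rw [h1]; simp [hax, hay])

theorem face_iff_of_firstReturn {x y : M.Dart} {i : N.Dart → M.Dart} (hi : Function.Injective i)
    (hS : ∀ d, i d ∉ ({x, y} : Set M.Dart))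
    (h : ∀ d, FirstReturn (M.rotW * M.rotB) {x, y} (i d) (i (N.rotW (N.rotB d)))) (d d' : N.Dart) :
    M.face (i d) = M.face (i d') ↔ N.face d = N.face d' := by
  rw [BipartiteMap.face_eq, BipartiteMap.face_eq, BipartiteMap.sameCycle_faceRot_iff,
    BipartiteMap.sameCycle_faceRot_iff]
  exact FirstReturn.sameCycle_iff hi hS h d d'

theorem isLeg_iff_of_sameCycle {i : N.Dart → M.Dart} (hroot : M.IsLeg (i N.root))
    (h : ∀ d d', M.rotB.SameCycle (i d) (i d') ↔ N.rotB.SameCycle d d') (d : N.Dart) :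
    M.IsLeg (i d) ↔ N.IsLeg d := by
  unfold BipartiteMap.IsLeg at *
  rw [← h]
  exact ⟨fun h1 => hroot.symm.trans h1, fun h1 => hroot.trans h1⟩

/-- Since `rotB` exchanges `x` and `y`, the face on the right of each is the one on the left of the
other: their arrows are opposite. The black rotation of the other darts is untouched, the rotations
at the two white ends are spliced, and a face walk merely skips `x` or `y`. The absence of white
leaves makes the spliced rotation leave `{x, y}` after one step. -/
theorem ContractBlack.exists_reduces (h : M.ContractBlack N) (hw : ∀ e, M.rotW e ≠ e) :
    ∃ x y i, Reduces M N x y i ∧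
      (∀ d, i (N.rotB d) = M.rotB (i d)) ∧
      (∀ d d', M.rotB.SameCycle (i d) (i d') ↔ N.rotB.SameCycle d d') ∧
      ∀ d, i (N.rotW d) = M.rotW (i d) ∨ M.rotW (i d) = x ∧ i (N.rotW d) = M.rotW y ∨
        M.rotW (i d) = y ∧ i (N.rotW d) = M.rotW x := by
  obtain ⟨x, y, hxy, hx, hBx, hBy, hWxy, i, hi, hrange, hW, hB, hroot, hlabel⟩ := h
  obtain ⟨hS, hix, hiy, hcov, hcov'⟩ := cover_of_range hrange
  have hxy' : M.rotW x ≠ y := fun h => hWxy (by rw [← h, M.white_rotW])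
  have hyx' : M.rotW y ≠ x := fun h => hWxy (by rw [← h, M.white_rotW])
  have hBi : ∀ d, i (N.rotB d) = M.rotB (i d) := fun d =>
    firstReturn_exchange hBx hBy (hix d) (hiy d) (hB d)
  have hWi : ∀ d, i (N.rotW d) = M.rotW (i d) ∧ M.rotW (i d) ≠ x ∧ M.rotW (i d) ≠ y ∨
      M.rotW (i d) = x ∧ i (N.rotW d) = M.rotW y ∨
      M.rotW (i d) = y ∧ i (N.rotW d) = M.rotW x := fun d =>
    firstReturn_merge (hix d) (hiy d) (hix _) (hiy _) ⟨hw x, hxy'⟩ ⟨hyx', hw y⟩ (hW d)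
  have hBc := FirstReturn.sameCycle_iff hi hS fun d => .single (hBi d).symm
  have hlx : M.label (M.rotW x) = M.label y := by
    rw [← hBy, label_rotW_rotB]
  have hly : M.label (M.rotW y) = M.label x := by
    rw [← hBx, label_rotW_rotB]
  have hlegy : ¬ M.IsLeg y := by rwa [← hBx, BipartiteMap.isLeg_rotB_iff]
  have hleg := isLeg_iff_of_sameCycle hroot hBc
  refine ⟨x, y, i, ⟨hxy, hi, hix, hiy, hcov, hlabel, fun d => ?_, hleg,
    face_iff_of_firstReturn hi hS fun d => ?_, fun e => ?_, fun e he => ?_,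
    hx, .inl ⟨hlegy, hlx, hly⟩⟩, hBi, hBc, fun d => (hWi d).imp_left And.left⟩
  · rw [← hlabel]
    rcases hWi d with ⟨h1, -⟩ | ⟨h1, h2⟩ | ⟨h1, h2⟩
    · rw [h1]
    · rw [h1, h2, hly]
    · rw [h1, h2, hlx]
  · rcases hWi (N.rotB d) with ⟨h1, -⟩ | ⟨h1, h2⟩ | ⟨h1, h2⟩
    · refine .single ?_
      rw [h1, hBi, Perm.mul_apply]
    · rw [hBi] at h1
      refine .head (by simp [h1]) (.single ?_)
      rw [Perm.mul_apply, Perm.mul_apply, h1, hBx, h2]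
    · rw [hBi] at h1
      refine .head (by simp [h1]) (.single ?_)
      rw [Perm.mul_apply, Perm.mul_apply, h1, hBy, h2]
  · rcases hcov e with rfl | rfl | ⟨d, rfl⟩
    · obtain ⟨d, hd⟩ := hcov' (M.rotW y) hyx' (hw y)
      exact ⟨d, by rw [hd, ← hBx, face_rotW_rotB]⟩
    · obtain ⟨d, hd⟩ := hcov' (M.rotW x) (hw x) hxy'
      exact ⟨d, by rw [hd, ← hBy, face_rotW_rotB]⟩
    · exact ⟨d, rfl⟩
  · rcases hcov e with rfl | rfl | ⟨d, rfl⟩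
    · exact absurd he hx
    · exact absurd he hlegy
    · exact ⟨d, (hleg d).1 he, (hlabel d).symm⟩

/-- The face around a leaf lies on both sides of its edge `x`, so the arrow across `x` is a loop.
The leg `y` has the same label as the leg before it, so the set of frozen labels survives. -/
theorem PruneLeaf.exists_reduces (h : M.PruneLeaf N) :
    ∃ x y i, Reduces M N x y i ∧
      (∀ d, i (N.rotW d) = M.rotW (i d)) ∧
      (∀ d d', M.rotB.SameCycle (i d) (i d') ↔ N.rotB.SameCycle d d') ∧
      ∀ d, ¬ M.IsLeg (i d) → i (N.rotB d) = M.rotB (i d) := by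
  obtain ⟨x, y, hx, hy, hBx, hBy, hWx, hWy, i, hi, hrange, hW, hB, hroot, hlabel⟩ := h
  obtain ⟨hS, hix, hiy, hcov, hcov'⟩ := cover_of_range hrange
  have hxy : x ≠ y := by rintro rfl; exact hx hy
  have hByx : M.rotB y ≠ x := fun h => hxy (M.rotB.injective (hBx.trans h.symm))
  have hWi : ∀ d, i (N.rotW d) = M.rotW (i d) := fun d =>
    firstReturn_exchange hWx hWy (hix d) (hiy d) (hW d)
  have hBnx : ∀ d, M.rotB (i d) ≠ x := fun d h =>
    hix d (M.rotB.injective (h.trans hBx.symm))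
  have hBi : ∀ d, i (N.rotB d) = M.rotB (i d) ∧ M.rotB (i d) ≠ y ∨
      M.rotB (i d) = y ∧ i (N.rotB d) = M.rotB y := by
    intro d
    have h1 : (M.rotB * swap x y) (i d) = M.rotB (i d) := mul_swap_apply _ (hix d) (hiy d)
    by_cases hd : M.rotB (i d) = y
    · refine .inr ⟨hd, ?_⟩
      -- The merged rotation passes from `i d` to `y`, from there to `rotB x = x`, and only then to
      -- `rotB y`.
      have h2 : FirstReturn _ _ _ _ := FirstReturn.tail (hB d) (by simp [h1, hd]) (hS _)
      rw [h1, hd] at h2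
      have h3 := h2.tail (by rw [mul_swap_apply_right, hBx]; simp) (hS _)
      rw [mul_swap_apply_right, hBx] at h3
      rw [← mul_swap_apply_left M.rotB x y]
      exact h3.eq_of_notMem (by rw [mul_swap_apply_left]; simp [hBy, hByx])
    · refine .inl ⟨?_, hd⟩
      rw [← h1]
      exact FirstReturn.eq_of_notMem (hB d) (by rw [h1]; simp [hd, hBnx])
  have hBc := FirstReturn.sameCycle_iff hi hS (ρ := M.rotB) (τ := N.rotB) fun d => by
    rcases hBi d with ⟨h1, -⟩ | ⟨h1, h2⟩
    · exact .single h1.symm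
    · exact .head (by simp [h1]) (.single (by rw [h1, h2]))
  have hleg := isLeg_iff_of_sameCycle hroot hBc
  have hlx : M.label y = M.label x := by
    rw [← hWx]
    nth_rw 1 [← hBx]
    rw [label_rotW_rotB]
  refine ⟨x, y, i, ⟨hxy, hi, hix, hiy, hcov, hlabel, fun d => ?_, hleg,
    face_iff_of_firstReturn hi hS fun d => ?_, fun e => ?_, fun e he => ?_,
    hx, .inr ⟨hy, by rw [hWx, hlx]⟩⟩, hWi, hBc, fun d hd => ?_⟩
  · rw [← hlabel, hWi]
  · rw [hWi]
    rcases hBi d with ⟨h1, -⟩ | ⟨h1, h2⟩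
    · exact .single (by rw [Perm.mul_apply, h1])
    · refine .head (by simp [h1, hWy]) (.head ?_ (.single ?_))
      · simp [h1, hWy, hBx, hWx]
      · simp [h1, hWy, hBx, hWx, h2]
  · have hy' : ∃ d, M.face y = M.face (i d) := by
      obtain ⟨d, hd⟩ := hcov' (M.rotW (M.rotB y))
        (fun h => hBy (M.rotW.injective (h.trans hWy.symm)))
        (fun h => hByx (M.rotW.injective (h.trans hWx.symm)))
      exact ⟨d, by rw [hd, face_rotW_rotB]⟩
    rcases hcov e with rfl | rfl | ⟨d, rfl⟩
    · rw [← face_rotW_rotB, hBx, hWx]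
      exact hy'
    · exact hy'
    · exact ⟨d, rfl⟩
  · rcases hcov e with rfl | rfl | ⟨d, rfl⟩
    · exact absurd he hx
    -- The preceding leg replaces the lost one; it is a different dart because `rotB y ≠ y`.
    · have hBe : M.rotB (M.rotB⁻¹ e) = e := perm_apply_inv_self _ _
      obtain ⟨d, hd⟩ := hcov' (M.rotB⁻¹ e)
        (fun h => hxy (by rw [← hBe, h, hBx]))
        (fun h => hBy (by nth_rw 2 [← hBe]; rw [h]))
      refine ⟨d, (hleg d).1 ?_, ?_⟩
      · rwa [hd, BipartiteMap.isLeg_rotB_inv_iff]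
      · rw [← hlabel, hd, ← label_rotW, hWy, hlx]
    · exact ⟨d, (hleg d).1 he, (hlabel d).symm⟩
  · rcases hBi d with ⟨h1, -⟩ | ⟨h1, h2⟩
    · exact h1
    · rw [← BipartiteMap.isLeg_rotB_iff, h1] at hd
      exact absurd hy hd

/-- The split graph `N` reduces to `M`. -/
theorem SplitBlack.exists_reduces (h : M.SplitBlack N) :
    ∃ x y i, Reduces N M x y i ∧ N.rotW x = y ∧ N.rotW y = x ∧ ¬ N.rotB.SameCycle x y ∧
      (∀ z, z = x ∨ z = y → ¬ N.IsLeg z ∧ N.rotB z ≠ z ∧ N.rotB (N.rotB z) ≠ z) ∧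
      (∀ d, i (M.rotW d) = N.rotW (i d)) ∧
      ∀ d, i (M.rotB d) = N.rotB (i d) ∧ N.rotB (i d) ≠ x ∧ N.rotB (i d) ≠ y ∨
        N.rotB (i d) = x ∧ i (M.rotB d) = N.rotB y ∨
        N.rotB (i d) = y ∧ i (M.rotB d) = N.rotB x := by
  obtain ⟨x, y, hxy, hWx, hWy, hblack, hz, i, hi, hrange, hW, hB, hroot, hlabel⟩ := h
  obtain ⟨hS, hix, hiy, hcov, hcov'⟩ := cover_of_range hrange
  have hBxy : ¬ N.rotB.SameCycle x y := fun h => hblack (BipartiteMap.black_eq.2 h)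
  have hxy' : N.rotB x ≠ y := fun h =>
    hBxy (h ▸ Perm.sameCycle_apply_right.2 (Perm.SameCycle.refl _ _))
  have hyx' : N.rotB y ≠ x := fun h =>
    hBxy (h ▸ Perm.sameCycle_apply_left.2 (Perm.SameCycle.refl _ _))
  have hx := hz x (.inl rfl)
  have hy := hz y (.inr rfl)
  have hWi : ∀ d, i (M.rotW d) = N.rotW (i d) := fun d =>
    firstReturn_exchange hWx hWy (hix d) (hiy d) (hW d)
  have hBi : ∀ d, i (M.rotB d) = N.rotB (i d) ∧ N.rotB (i d) ≠ x ∧ N.rotB (i d) ≠ y ∨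
      N.rotB (i d) = x ∧ i (M.rotB d) = N.rotB y ∨
      N.rotB (i d) = y ∧ i (M.rotB d) = N.rotB x := fun d =>
    firstReturn_merge (hix d) (hiy d) (hix _) (hiy _) ⟨hx.2.1, hxy'⟩ ⟨hyx', hy.2.1⟩ (hB d)
  have hBl : ∀ d, N.IsLeg (i d) → i (M.rotB d) = N.rotB (i d) := by
    intro d hd
    rw [← BipartiteMap.isLeg_rotB_iff] at hd
    rcases hBi d with ⟨h1, -⟩ | ⟨h1, -⟩ | ⟨h1, -⟩
    · exact h1
    · exact absurd (h1 ▸ hd) hx.1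
    · exact absurd (h1 ▸ hd) hy.1
  -- The black cycles of `M` and `N` do not correspond, as two of them are merged. Neither contains
  -- a leg, so the legs are matched by following the rotation around `∞` from the root.
  have hpow : ∀ n : ℕ, N.IsLeg (i ((M.rotB ^ n) M.root)) ∧
      (N.rotB ^ n) (i M.root) = i ((M.rotB ^ n) M.root) := by
    intro n
    induction n with
    | zero => exact ⟨hroot, rfl⟩
    | succ n ih =>
      simp only [pow_succ', Perm.mul_apply, hBl _ ih.1, BipartiteMap.isLeg_rotB_iff, ih.1, ih.2,
        and_self]
  have hleg : ∀ d, N.IsLeg (i d) ↔ M.IsLeg d := by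
    intro d
    constructor
    · intro hd
      obtain ⟨n, hn⟩ := (hroot.symm.trans hd).exists_nat_pow_eq
      rw [(hpow n).2] at hn
      exact ⟨n, by rw [zpow_natCast]; exact hi hn⟩
    · intro hd
      obtain ⟨n, rfl⟩ := Perm.SameCycle.exists_nat_pow_eq hd
      exact (hpow n).1
  refine ⟨x, y, i, ⟨hxy, hi, hix, hiy, hcov, hlabel, fun d => ?_, hleg,
    face_iff_of_firstReturn hi hS fun d => ?_, fun e => ?_, fun e he => ?_,
    hx.1, .inl ⟨hy.1, by rw [hWx], by rw [hWy]⟩⟩, hWx, hWy, hBxy, hz, hWi, hBi⟩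
  · rw [← hlabel, hWi]
  · rw [hWi]
    rcases hBi d with ⟨h1, -⟩ | ⟨h1, h2⟩ | ⟨h1, h2⟩
    · exact .single (by rw [Perm.mul_apply, h1])
    · exact .head (by simp [h1, hWx]) (.single (by simp [h1, hWx, h2]))
    · exact .head (by simp [h1, hWy]) (.single (by simp [h1, hWy, h2]))
  · rcases hcov e with rfl | rfl | ⟨d, rfl⟩
    · obtain ⟨d, hd⟩ := hcov' (N.rotW (N.rotB e))
        (fun h => hxy' (N.rotW.injective (h.trans hWy.symm)))
        (fun h => hx.2.1 (N.rotW.injective (h.trans hWx.symm)))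
      exact ⟨d, by rw [hd, face_rotW_rotB]⟩
    · obtain ⟨d, hd⟩ := hcov' (N.rotW (N.rotB e))
        (fun h => hy.2.1 (N.rotW.injective (h.trans hWy.symm)))
        (fun h => hyx' (N.rotW.injective (h.trans hWx.symm)))
      exact ⟨d, by rw [hd, face_rotW_rotB]⟩
    · exact ⟨d, rfl⟩
  · rcases hcov e with rfl | rfl | ⟨d, rfl⟩
    · exact absurd he hx.1
    · exact absurd he hy.1
    · exact ⟨d, (hleg d).1 he, (hlabel d).symm⟩

end LabelledMap

/-! ### Invariants carried from the star graph to a section graph -/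

namespace LabelledMap

variable {W : Type} {M N : LabelledMap W}

open Classical in
/-- The number of edges with a face labelled `u` on their right and one labelled `v` on their
left. -/
noncomputable def arrowCount (M : LabelledMap W) (u v : W) : ℤ :=
  ∑ d : M.Dart, if ¬ M.IsLeg d ∧ M.label (M.rotW d) = u ∧ M.label d = v then 1 else 0

/-- The faces are in bijection with the labels, the labels in `b` are those of the boundary faces,
and the numbers of arrows of the dual quiver are given by `q`. -/
structure HasDualQuiver (M : LabelledMap W) (b : W → Prop) (q : W → W → ℤ) : Prop where
  face_eq : ∀ e e', M.label e = M.label e' → M.face e = M.face e'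
  surjective : Function.Surjective M.label
  frozen : ∀ w, (∃ e, M.IsLeg e ∧ M.label e = w) ↔ b w
  arrows : ∀ u v, M.arrowCount u v - M.arrowCount v u = q u v

/-- No black vertex other than `∞` is a leaf. -/
def NoLeaf (M : LabelledMap W) : Prop := ∀ e, ¬ M.IsLeg e → M.rotB e ≠ e

/-- The labels of any three darts at a black vertex other than `∞` satisfy `R`. -/
def TriplesSatisfy (M : LabelledMap W) (R : W → W → W → Prop) : Prop :=
  ∀ e₁ e₂ e₃, ¬ M.IsLeg e₁ → M.rotB.SameCycle e₁ e₂ → M.rotB.SameCycle e₁ e₃ →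
    e₁ ≠ e₂ → e₂ ≠ e₃ → e₁ ≠ e₃ → R (M.label e₁) (M.label e₂) (M.label e₃)

/-- Consecutive faces around a white vertex have labels with different values of `z`. -/
def Separated (M : LabelledMap W) (z : W → ℂ) : Prop :=
  ∀ e, z (M.label e) ≠ z (M.label (M.rotW e))

/-- Consecutive faces around a white vertex have labels with different values of `z`, except
possibly next to black leaves. -/
def SeparatedUpToLeaves (M : LabelledMap W) (z : W → ℂ) : Prop :=
  ∀ e, z (M.label e) ≠ z (M.label (M.rotW e)) ∨ (¬ M.IsLeg e ∧ M.rotB e = e) ∨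
    (¬ M.IsLeg (M.rotW e) ∧ M.rotB (M.rotW e) = M.rotW e)

/-- The vectors at the faces around a white vertex lie on a line, on which `z` is a coordinate. -/
def HasDirections {V : Type} [AddCommGroup V] [Module ℂ V] (M : LabelledMap W) (v : W → V)
    (z : W → ℂ) : Prop :=
  ∃ u : M.Dart → V, (∀ e, u (M.rotW e) = u e) ∧ ∀ e,
    v (M.label e) - v (M.label (M.rotW e)) =
      (z (M.label e) - z (M.label (M.rotW e))) • u e

theorem SeparatedUpToLeaves.separated {z : W → ℂ} (h : M.SeparatedUpToLeaves z) (hM : M.NoLeaf) :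
    M.Separated z := fun e =>
  (h e).resolve_right fun h' => h'.elim (fun h => hM _ h.1 h.2) (fun h => hM _ h.1 h.2)

theorem Separated.rotW_ne {z : W → ℂ} (h : M.Separated z) (e : M.Dart) : M.rotW e ≠ e :=
  fun he => h e (by rw [he])

namespace Reduces

variable {x y : M.Dart} {i : N.Dart → M.Dart} {b : W → Prop} {q : W → W → ℤ}

theorem sum_eq {A : Type} [AddCommMonoid A] (h : Reduces M N x y i) (g : M.Dart → A) :
    ∑ e, g e = g x + (g y + ∑ d, g (i d)) := by
  classical
  have hu : (Finset.univ : Finset M.Dart) = insert x (insert y (Finset.univ.image i)) := by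
    ext e
    rcases h.cover e with rfl | rfl | ⟨d, rfl⟩ <;> simp
  rw [hu, Finset.sum_insert, Finset.sum_insert, Finset.sum_image fun a _ b _ hab => h.injective hab]
  · simpa using h.ne_right
  · simpa using ⟨h.ne, h.ne_left⟩

/-- By `cancel`, the removed darts carry either two opposite arrows or, when `y` is a leg, one loop;
both vanish in the antisymmetrized count. -/
theorem arrowCount_sub (h : Reduces M N x y i) (u v : W) :
    M.arrowCount u v - M.arrowCount v u = N.arrowCount u v - N.arrowCount v u := by
  classical
  simp only [arrowCount, h.sum_eq, h.isLeg_iff, h.label_eq, h.label_rotW_eq]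
  obtain ⟨hx, ⟨hy, h1, h2⟩ | ⟨hy, h1⟩⟩ := h.cancel
  · simp only [hx, hy, h1, h2, not_false_eq_true, true_and, and_comm (a := M.label y = u),
      and_comm (a := M.label y = v)]
    ring
  · simp only [hx, hy, h1, not_false_eq_true, true_and, not_true_eq_false, false_and, if_false,
      and_comm (a := M.label x = u)]
    ring

theorem hasDualQuiver_iff (h : Reduces M N x y i) :
    M.HasDualQuiver b q ↔ N.HasDualQuiver b q := by
  have hlab : ∀ e, ∃ d, M.face e = M.face (i d) ∧ M.label e = N.label d := fun e => by
    obtain ⟨d, hd⟩ := h.exists_face_eq e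
    exact ⟨d, hd, by rw [← h.label_eq, label_eq_of_face_eq hd]⟩
  have hfr : ∀ w, (∃ e, M.IsLeg e ∧ M.label e = w) ↔ ∃ d, N.IsLeg d ∧ N.label d = w := by
    intro w
    constructor
    · rintro ⟨e, he, rfl⟩
      exact h.exists_leg e he
    · rintro ⟨d, hd, rfl⟩
      exact ⟨i d, (h.isLeg_iff d).2 hd, h.label_eq d⟩
  constructor
  · intro hM
    refine ⟨fun d d' hd => ?_, fun w => ?_, fun w => ?_, fun u v => ?_⟩
    · rw [← h.face_iff]
      exact hM.face_eq _ _ (by rw [h.label_eq, h.label_eq, hd])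
    · obtain ⟨e, rfl⟩ := hM.surjective w
      obtain ⟨d, -, hd⟩ := hlab e
      exact ⟨d, hd.symm⟩
    · rw [← hfr, hM.frozen]
    · rw [← h.arrowCount_sub, hM.arrows]
  · intro hN
    refine ⟨fun e e' he => ?_, fun w => ?_, fun w => ?_, fun u v => ?_⟩
    · obtain ⟨d, hd, hl⟩ := hlab e
      obtain ⟨d', hd', hl'⟩ := hlab e'
      rw [hd, hd', h.face_iff]
      exact hN.face_eq _ _ (by rw [← hl, ← hl', he])
    · obtain ⟨d, rfl⟩ := hN.surjective w
      exact ⟨i d, h.label_eq d⟩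
    · rw [hfr, hN.frozen]
    · rw [h.arrowCount_sub, hN.arrows]

theorem triplesSatisfy {R : W → W → W → Prop} (h : Reduces M N x y i)
    (hB : ∀ d d', M.rotB.SameCycle (i d) (i d') ↔ N.rotB.SameCycle d d')
    (hM : M.TriplesSatisfy R) : N.TriplesSatisfy R := by
  intro e₁ e₂ e₃ h0 h12 h13 n12 n23 n13
  simp only [← h.label_eq]
  exact hM _ _ _ (by rwa [h.isLeg_iff]) (by rwa [hB]) (by rwa [hB]) (h.injective.ne n12)
    (h.injective.ne n23) (h.injective.ne n13)

end Reduces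

variable {V : Type} [AddCommGroup V] [Module ℂ V]

/-- The properties of the star graph that persist when it is transformed into a section graph. -/
structure Compatible (M : LabelledMap W) (b : W → Prop) (q : W → W → ℤ) (R : W → W → W → Prop)
    (v : W → V) (z : W → ℂ) : Prop where
  dualQuiver : M.HasDualQuiver b q
  triples : M.TriplesSatisfy R
  directions : M.HasDirections v z

variable {b : W → Prop} {q : W → W → ℤ} {R : W → W → W → Prop} {v : W → V} {z : W → ℂ}

theorem Compatible.prune (hM : M.Compatible b q R v z) (hz : M.SeparatedUpToLeaves z)
    (h : M.PruneLeaf N) : N.Compatible b q R v z ∧ N.SeparatedUpToLeaves z := by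
  obtain ⟨x, y, i, hred, hW, hBc, hB⟩ := h.exists_reduces
  obtain ⟨u, hu, huv⟩ := hM.directions
  refine ⟨⟨hred.hasDualQuiver_iff.1 hM.dualQuiver, hred.triplesSatisfy hBc hM.triples,
    u ∘ i, fun d => ?_, fun d => ?_⟩, fun d => ?_⟩
  · rw [Function.comp_apply, hW, hu, Function.comp_apply]
  · rw [← hred.label_eq, ← hred.label_rotW_eq]
    exact huv (i d)
  · rw [← hred.label_eq, ← hred.label_rotW_eq, ← hred.isLeg_iff, ← hred.isLeg_iff, hW]
    refine (hz (i d)).imp_right (Or.imp (fun h1 => ⟨h1.1, ?_⟩) (fun h1 => ⟨h1.1, ?_⟩))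
    · exact hred.injective (by rw [hB _ h1.1, h1.2])
    · exact hred.injective (by rw [hB _ (by rw [hW]; exact h1.1), hW, h1.2])

/-- The two white vertices that are merged share the two faces along the contracted path. These have
different `z`, so they determine the direction, which is therefore the same at both vertices. -/
theorem Compatible.contract (hM : M.Compatible b q R v z) (hz : M.Separated z)
    (h : M.ContractBlack N) : N.Compatible b q R v z ∧ N.Separated z := by
  obtain ⟨x, y, i, hred, hB, hBc, hW⟩ := h.exists_reduces hz.rotW_ne
  obtain ⟨u, hu, huv⟩ := hM.directions
  have hlabel : M.label (M.rotW x) = M.label y ∧ M.label (M.rotW y) = M.label x := by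
    obtain ⟨-, ⟨-, h1, h2⟩ | ⟨-, h1⟩⟩ := hred.cancel
    · exact ⟨h1, h2⟩
    · exact absurd (by rw [h1]) (hz x)
  have hxy : u x = u y := by
    have h1 := huv x
    have h2 := huv y
    have hne := hz x
    rw [hlabel.1] at h1 hne
    rw [hlabel.2] at h2
    have h3 : (z (M.label x) - z (M.label y)) • (u x - u y) = 0 := by
      rw [smul_sub, ← h1, ← neg_sub (z (M.label y)) (z (M.label x)), neg_smul, ← h2]
      abel
    exact sub_eq_zero.1 ((smul_eq_zero.1 h3).resolve_left (sub_ne_zero.2 hne))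
  refine ⟨⟨hred.hasDualQuiver_iff.1 hM.dualQuiver, hred.triplesSatisfy hBc hM.triples,
    u ∘ i, fun d => ?_, fun d => ?_⟩, fun d => ?_⟩
  · rw [Function.comp_apply, Function.comp_apply, ← hu (i d)]
    rcases hW d with h1 | ⟨h1, h2⟩ | ⟨h1, h2⟩
    · rw [h1]
    · rw [h1, h2, hu, hxy]
    · rw [h1, h2, hu, hxy]
  · rw [← hred.label_eq, ← hred.label_rotW_eq]
    exact huv (i d)
  · rw [← hred.label_eq, ← hred.label_rotW_eq]
    exact hz (i d)

/-- A leaf would survive the contraction. Read backwards from the trivalent section graph, this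
shows that all leaves were removed at the pruning stage. -/
theorem ContractBlack.noLeaf (h : M.ContractBlack N) (hN : N.NoLeaf) : M.NoLeaf := by
  obtain ⟨x, y, hxy, hx, hBx, hBy, -, i, hi, hrange, -, hB, hroot, -⟩ := h
  obtain ⟨hS, hix, hiy, hcov, -⟩ := cover_of_range hrange
  have hBi : ∀ d, i (N.rotB d) = M.rotB (i d) := fun d =>
    firstReturn_exchange hBx hBy (hix d) (hiy d) (hB d)
  have hleg := isLeg_iff_of_sameCycle hroot
    (FirstReturn.sameCycle_iff hi hS fun d => .single (hBi d).symm)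
  intro e he hBe
  rcases hcov e with rfl | rfl | ⟨d, rfl⟩
  · exact hxy (hBe.symm.trans hBx)
  · exact hxy (hBy.symm.trans hBe)
  · exact hN d (by rwa [← hleg]) (hi (by rw [hBi, hBe]))

theorem SplitBlack.noLeaf (h : M.SplitBlack N) (hN : N.NoLeaf) : M.NoLeaf := by
  obtain ⟨x, y, i, hred, -, -, hBxy, -, -, hB⟩ := h.exists_reduces
  intro d hd hBd
  have h1 := hB d
  rw [hBd] at h1
  rcases h1 with ⟨h1, -⟩ | ⟨h1, h2⟩ | ⟨h1, h2⟩
  · exact hN (i d) (by rwa [hred.isLeg_iff]) h1.symm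
  · rw [h2] at h1
    -- Here the leaf `d` would follow `y` and precede `x` in `N`, putting `x` and `y` at the same
    -- vertex.
    exact hBxy (Perm.SameCycle.symm ⟨2, by rw [← h1]; rfl⟩)
  · rw [h2] at h1
    exact hBxy ⟨2, by rw [← h1]; rfl⟩

/-- Splitting a black vertex distributes its darts, with their labels, injectively over the two new
vertices. -/
theorem SplitBlack.exists_label_map (h : M.SplitBlack N) : ∃ π : N.Dart → M.Dart,
    (∀ e, M.label (π e) = N.label e) ∧ (∀ e, ¬ N.IsLeg e → ¬ M.IsLeg (π e)) ∧
    ∀ e e', N.rotB.SameCycle e e' → M.rotB.SameCycle (π e) (π e') ∧ (π e = π e' → e = e') := by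
  obtain ⟨x, y, i, hred, hWx, hWy, hBxy, hz, -, hB⟩ := h.exists_reduces
  have hBxy' : N.rotB x ≠ y := fun h =>
    hBxy (h ▸ Perm.sameCycle_apply_right.2 (Perm.SameCycle.refl _ _))
  have hByx' : N.rotB y ≠ x := fun h =>
    hBxy (h ▸ Perm.sameCycle_apply_left.2 (Perm.SameCycle.refl _ _))
  have hx := hz x (.inl rfl)
  have hy := hz y (.inr rfl)
  have hpre : ∀ e', (∃ e, N.rotB e = e') := fun e' => ⟨N.rotB⁻¹ e', perm_apply_inv_self _ _⟩
  -- An old dart goes to itself. The new dart `x` goes to the dart preceding `y` at the other new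
  -- vertex, which has the same face on its left; likewise for `y`.
  have hex : ∀ e, ∃ d, i d = e ∨ e = x ∧ N.rotB (i d) = y ∨ e = y ∧ N.rotB (i d) = x := by
    intro e
    rcases hred.cover e with rfl | rfl | ⟨d, rfl⟩
    · obtain ⟨e', he'⟩ := hpre y
      rcases hred.cover e' with rfl | rfl | ⟨d, rfl⟩
      · exact absurd he' hBxy'
      · exact absurd he' hy.2.1
      · exact ⟨d, .inr (.inl ⟨rfl, he'⟩)⟩
    · obtain ⟨e', he'⟩ := hpre x
      rcases hred.cover e' with rfl | rfl | ⟨d, rfl⟩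
      · exact absurd he' hx.2.1
      · exact absurd he' hByx'
      · exact ⟨d, .inr (.inr ⟨rfl, he'⟩)⟩
    · exact ⟨d, .inl rfl⟩
  -- The predecessors `p` of `x` and `q` of `y` share a black vertex of `M`: going once around the
  -- `N`-vertex of `y` leads from `rotB y`, the `M`-successor of `p`, to `q`.
  have hpq : ∀ p q, N.rotB (i p) = x → N.rotB (i q) = y → cycleMk M.rotB p = cycleMk M.rotB q := by
    intro p q hp hq
    have hn : ∀ n : ℕ, (N.rotB ^ n) y = y ∨
        ∃ d, i d = (N.rotB ^ n) y ∧ cycleMk M.rotB d = cycleMk M.rotB p := by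
      intro n
      induction n with
      | zero => exact .inl rfl
      | succ n ih =>
        simp only [pow_succ', Perm.mul_apply]
        rcases ih with h1 | ⟨d, h1, h2⟩
        · rw [h1]
          rcases hB p with ⟨-, h3, -⟩ | ⟨-, h3⟩ | ⟨h3, -⟩
          · exact absurd hp h3
          · exact .inr ⟨_, h3, cycleMk_apply _ _⟩
          · exact absurd (hp.symm.trans h3) hred.ne
        · rw [← h1]
          rcases hB d with ⟨h3, -⟩ | ⟨h3, -⟩ | ⟨h3, -⟩
          · exact .inr ⟨_, h3, by rw [cycleMk_apply, h2]⟩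
          · refine absurd ?_ hBxy
            rw [← h3, h1, Perm.sameCycle_apply_left]
            exact Perm.sameCycle_pow_left.2 (Perm.SameCycle.refl _ _)
          · exact .inl h3
    obtain ⟨n, hnq⟩ := Perm.SameCycle.exists_nat_pow_eq
      (show N.rotB.SameCycle y (i q) by
        rw [← hq]; exact Perm.sameCycle_apply_left.2 (Perm.SameCycle.refl _ _))
    rcases hn n with h1 | ⟨d, h1, h2⟩
    · exact absurd (hnq.symm.trans h1) (hred.ne_right q)
    · rw [← h2, hred.injective (h1.trans hnq)]
  choose π hπ using hex
  have hstep : ∀ e, cycleMk M.rotB (π (N.rotB e)) = cycleMk M.rotB (π e) := by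
    intro e
    rcases hπ e with h1 | ⟨h1, h2⟩ | ⟨h1, h2⟩
    · rcases hπ (N.rotB e) with h3 | ⟨h3, h4⟩ | ⟨h3, h4⟩
      · rcases hB (π e) with ⟨h5, -⟩ | ⟨h5, -⟩ | ⟨h5, -⟩
        · rw [h1, ← h3] at h5
          rw [← hred.injective h5, cycleMk_apply]
        · rw [h1, ← h3] at h5
          exact absurd h5 (hred.ne_left _)
        · rw [h1, ← h3] at h5
          exact absurd h5 (hred.ne_right _)
      · exact (hpq _ _ (by rw [h1, h3]) h4).symm
      · exact hpq _ _ h4 (by rw [h1, h3])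
    · rcases hB (π e) with ⟨-, -, h5⟩ | ⟨h5, -⟩ | ⟨-, h5⟩
      · exact absurd h2 h5
      · exact absurd (h5.symm.trans h2) hred.ne
      · rcases hπ (N.rotB e) with h3 | ⟨h3, h4⟩ | ⟨h3, h4⟩
        · rw [h1] at h3 ⊢
          rw [h1] at h5
          rw [← hred.injective (h5.trans h3.symm), cycleMk_apply]
        · exact absurd (by rwa [h1] at h3) hx.2.1
        · exact absurd (by rwa [h1] at h3) hBxy'
    · rcases hB (π e) with ⟨-, h5, -⟩ | ⟨-, h5⟩ | ⟨h5, -⟩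
      · exact absurd h2 h5
      · rcases hπ (N.rotB e) with h3 | ⟨h3, h4⟩ | ⟨h3, h4⟩
        · rw [h1] at h3 ⊢
          rw [h1] at h5
          rw [← hred.injective (h5.trans h3.symm), cycleMk_apply]
        · exact absurd (by rwa [h1] at h3) hByx'
        · exact absurd (by rwa [h1] at h3) hy.2.1
      · exact absurd (h2.symm.trans h5) hred.ne
  have apply_mem : ∀ e, N.rotB.SameCycle e (N.rotB e) := fun e =>
    Perm.sameCycle_apply_right.2 (Perm.SameCycle.refl _ _)
  refine ⟨π, fun e => ?_, fun e he => ?_, fun e e' hee => ⟨?_, fun hπe => ?_⟩⟩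
  · rw [← hred.label_eq]
    rcases hπ e with h1 | ⟨h1, h2⟩ | ⟨h1, h2⟩
    · rw [h1]
    · rw [← N.label_rotW_rotB, h2, hWy, h1]
    · rw [← N.label_rotW_rotB, h2, hWx, h1]
  · rw [← hred.isLeg_iff]
    rcases hπ e with h1 | ⟨h1, h2⟩ | ⟨h1, h2⟩
    · rwa [h1]
    · rw [← BipartiteMap.isLeg_rotB_iff, h2]
      exact hy.1
    · rw [← BipartiteMap.isLeg_rotB_iff, h2]
      exact hx.1
  · obtain ⟨n, rfl⟩ := hee.exists_nat_pow_eq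
    clear hee
    rw [← cycleMk_eq]
    induction n with
    | zero => rfl
    | succ n ih => rw [pow_succ', Perm.mul_apply, hstep, ih]
  -- `π x` sits at the vertex of `y` in `N` and vice versa, so no collision can happen within one
  -- black cycle of `N`.
  · rcases hπ e with h1 | ⟨h1, h2⟩ | ⟨h1, h2⟩ <;> rcases hπ e' with h3 | ⟨h3, h4⟩ | ⟨h3, h4⟩
    · rw [← h1, ← h3, hπe]
    · refine absurd ?_ hBxy
      rw [← hπe, h1] at h4
      rw [← h3, ← h4]
      exact hee.symm.trans (apply_mem e)
    · refine absurd ?_ hBxy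
      rw [← hπe, h1] at h4
      rw [← h3, ← h4]
      exact (apply_mem e).symm.trans hee
    · refine absurd ?_ hBxy
      rw [hπe, h3] at h2
      rw [← h1, ← h2]
      exact hee.trans (apply_mem e')
    · rw [h1, h3]
    · rw [hπe, h4] at h2
      exact absurd h2 hred.ne
    · refine absurd ?_ hBxy
      rw [hπe, h3] at h2
      rw [← h1, ← h2]
      exact (apply_mem e').symm.trans hee.symm
    · rw [hπe, h4] at h2
      exact absurd h2.symm hred.ne
    · rw [h1, h3]

/-- The new white vertex has only two faces around it. Their labels are two of at least three labels
at a new black vertex, so they have different `z` by `hR`, and their normalized difference serves as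
the direction there. -/
theorem Compatible.split (hM : M.Compatible b q R v z) (hz : M.Separated z)
    (hR : ∀ a b c, R a b c → z a ≠ z b) (h : M.SplitBlack N) :
    N.Compatible b q R v z ∧ N.Separated z := by
  have hN : N.TriplesSatisfy R := by
    obtain ⟨π, h1, h2, h3⟩ := h.exists_label_map
    intro e₁ e₂ e₃ h0 h12 h13 n12 n23 n13
    simp only [← h1]
    exact hM.triples _ _ _ (h2 _ h0) (h3 _ _ h12).1 (h3 _ _ h13).1
      (fun h => n12 ((h3 _ _ h12).2 h)) (fun h => n23 ((h3 _ _ (h12.symm.trans h13)).2 h))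
      (fun h => n13 ((h3 _ _ h13).2 h))
  obtain ⟨x, y, i, hred, hWx, hWy, hBxy, hz', hW, hB⟩ := h.exists_reduces
  have hsep : ∀ e, e = x ∨ e = y → z (N.label e) ≠ z (N.label (N.rotW e)) := by
    intro e he
    obtain ⟨h1, h2, h3⟩ := hz' e he
    obtain ⟨p, rfl⟩ : ∃ p, e = N.rotB p := ⟨N.rotB⁻¹ e, (perm_apply_inv_self _ _).symm⟩
    rw [N.label_rotW_rotB]
    refine (hR _ _ _ (hN p (N.rotB p) (N.rotB (N.rotB p)) ?_ ?_ ?_ ?_ ?_ ?_)).symm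
    · rwa [BipartiteMap.isLeg_rotB_iff] at h1
    · exact ⟨1, rfl⟩
    · exact ⟨2, rfl⟩
    · exact fun h => h2 (congrArg N.rotB h.symm)
    · exact h2.symm
    · exact fun h => h3 (congrArg N.rotB h.symm)
  have hNz : N.Separated z := by
    intro e
    rcases hred.cover e with h1 | h1 | ⟨d, rfl⟩
    · exact hsep e (.inl h1)
    · exact hsep e (.inr h1)
    · rw [hred.label_eq, hred.label_rotW_eq]
      exact hz d
  obtain ⟨u, hu, huv⟩ := hM.directions
  let c : V := (z (N.label x) - z (N.label y))⁻¹ • (v (N.label x) - v (N.label y))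
  have hc : v (N.label x) - v (N.label y) = (z (N.label x) - z (N.label y)) • c := by
    have hne := hNz x
    rw [hWx] at hne
    rw [smul_smul, mul_inv_cancel₀ (sub_ne_zero.2 hne), one_smul]
  have hix : Function.extend i u (fun _ => c) x = c :=
    Function.extend_apply' _ _ _ (by rintro ⟨d, hd⟩; exact hred.ne_left d hd)
  have hiy : Function.extend i u (fun _ => c) y = c :=
    Function.extend_apply' _ _ _ (by rintro ⟨d, hd⟩; exact hred.ne_right d hd)
  refine ⟨⟨hred.hasDualQuiver_iff.2 hM.dualQuiver, hN,
    Function.extend i u (fun _ => c), fun e => ?_, fun e => ?_⟩, hNz⟩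
  · rcases hred.cover e with rfl | rfl | ⟨d, rfl⟩
    · rw [hWx, hix, hiy]
    · rw [hWy, hix, hiy]
    · rw [← hW, hred.injective.extend_apply, hred.injective.extend_apply, hu]
  · rcases hred.cover e with rfl | rfl | ⟨d, rfl⟩
    · rw [hWx, hix, hc]
    · rw [hWy, hiy, ← neg_sub (v (N.label x)), hc, ← neg_sub (z (N.label x)), neg_smul]
    · rw [hred.injective.extend_apply, hred.label_eq, hred.label_rotW_eq, huv]

/-- A section graph inherits the properties of the star graph. -/
theorem Compatible.sectionGraph {A₀ A S : LabelledMap W} (h₀ : A₀.Compatible b q R v z)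
    (hz : A₀.SeparatedUpToLeaves z) (hR : ∀ a b c, R a b c → z a ≠ z b)
    (h1 : Relation.ReflTransGen PruneLeaf A₀ A) (h2 : Relation.ReflTransGen SplitBlack A M)
    (h3 : Relation.ReflTransGen ContractBlack M S) (hS : S.IsTrivalent) :
    S.Compatible b q R v z ∧ S.Separated z := by
  -- Absence of leaves is pulled back from `S` to `A`; only then does separation hold without
  -- exceptions and can be pushed forward through the splittings and contractions.
  have hM : M.NoLeaf := by
    clear h2 h1
    induction h3 using Relation.ReflTransGen.head_induction_on with
    | refl => exact fun e he => (hS e he).1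
    | head h _ ih => exact h.noLeaf ih
  have hA : A.NoLeaf := by
    clear h1 h3
    induction h2 using Relation.ReflTransGen.head_induction_on with
    | refl => exact hM
    | head h _ ih => exact h.noLeaf ih
  have cA : A.Compatible b q R v z ∧ A.SeparatedUpToLeaves z := by
    clear h2 hA
    induction h1 with
    | refl => exact ⟨h₀, hz⟩
    | tail _ h ih => exact ih.1.prune ih.2 h
  have cM : M.Compatible b q R v z ∧ M.Separated z := by
    clear h3 hM
    induction h2 with
    | refl => exact ⟨cA.1, cA.2.separated hA⟩
    | tail _ h ih => exact ih.1.split ih.2 hR h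
  clear hM hS
  induction h3 with
  | refl => exact cM
  | tail _ h ih => exact ih.1.contract ih.2 h

end LabelledMap

/-! ### Affine lifts and a generic coordinate -/

section AffineLift

variable {V W : Type} [AddCommGroup V] [Module ℂ V]

/-- `v` lifts the points of `T` to vectors on which the linear form `l` is `1`. -/
structure IsAffineLift (T : W → Projectivization ℂ V) (l : V →ₗ[ℂ] ℂ) (v : W → V) : Prop where
  eq_one : ∀ w, l (v w) = 1
  submodule_eq : ∀ w, (T w).submodule = Submodule.span ℂ {v w}

theorem exists_isAffineLift {T : W → Projectivization ℂ V} {l : V →ₗ[ℂ] ℂ}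
    (h : ∀ w, l (T w).rep ≠ 0) : ∃ v, IsAffineLift T l v := by
  refine ⟨fun w => (l (T w).rep)⁻¹ • (T w).rep, fun w => ?_, fun w => ?_⟩
  · rw [map_smul, smul_eq_mul, inv_mul_cancel₀ (h w)]
  · rw [Submodule.span_singleton_smul_eq (IsUnit.mk0 _ (inv_ne_zero (h w))),
      Projectivization.submodule_eq]

namespace IsAffineLift

variable {T : W → Projectivization ℂ V} {l : V →ₗ[ℂ] ℂ} {v : W → V}

theorem ne_zero (h : IsAffineLift T l v) (w : W) : v w ≠ 0 := fun h0 => by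
  simpa [h0] using h.eq_one w

theorem mk_eq (h : IsAffineLift T l v) (w : W) : Projectivization.mk ℂ (v w) (h.ne_zero w) = T w :=
  Projectivization.submodule_injective (by rw [Projectivization.submodule_mk, h.submodule_eq])

theorem ne (h : IsAffineLift T l v) {w w' : W} (hT : T w ≠ T w') : v w ≠ v w' := fun hv =>
  hT (Projectivization.submodule_injective (by rw [h.submodule_eq, h.submodule_eq, hv]))

/-- Three points on a line, the first two of which are different. -/
theorem exists_sub_eq_smul (h : IsAffineLift T l v) {L : Submodule ℂ V}
    (hL : Module.finrank ℂ L = 2) {a b c : W} (ha : (T a).submodule ≤ L)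
    (hb : (T b).submodule ≤ L) (hc : (T c).submodule ≤ L) (hab : T a ≠ T b) :
    ∃ α : ℂ, v b - v c = α • (v a - v b) := by
  rw [h.submodule_eq, Submodule.span_singleton_le_iff_mem] at ha hb hc
  have hli : LinearIndependent ℂ ![v a, v b] := by
    rw [LinearIndependent.pair_iff]
    intro s t hst
    have h1 := congrArg l hst
    simp only [map_add, map_smul, h.eq_one, smul_eq_mul, mul_one, map_zero] at h1
    -- Applying `l` to the relation gives `s + t = 0`, so a relation would force the two lifts to
    -- coincide.
    obtain rfl : t = -s := (neg_eq_of_add_eq_zero_right h1).symm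
    rw [neg_smul, ← sub_eq_add_neg, ← smul_sub, smul_eq_zero] at hst
    have := hst.resolve_right (sub_ne_zero.2 (h.ne hab))
    simp [this]
  have hle : Submodule.span ℂ (Set.range ![v a, v b]) ≤ L := by
    rw [Submodule.span_le]
    rintro _ ⟨j, rfl⟩
    fin_cases j <;> assumption
  have : FiniteDimensional ℂ L := Module.finite_of_finrank_pos (by omega)
  have heq := Submodule.eq_of_le_of_finrank_eq hle
    (by rw [finrank_span_eq_card hli, hL, Fintype.card_fin])
  rw [← heq] at hc
  simp only [Matrix.range_cons, Matrix.range_empty, Set.union_empty, Set.singleton_union] at hc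
  obtain ⟨α, β, hαβ⟩ := Submodule.mem_span_pair.1 hc
  have h1 := congrArg l hαβ
  simp only [map_add, map_smul, h.eq_one, smul_eq_mul, mul_one] at h1
  refine ⟨-α, ?_⟩
  rw [← hαβ, eq_sub_of_add_eq' h1]
  module

/-- Three points that span a plane have linearly independent lifts. -/
theorem linearIndependent (h : IsAffineLift T l v) {a b c : W} (hT : Module.finrank ℂ
    ((T a).submodule ⊔ (T b).submodule ⊔ (T c).submodule : Submodule ℂ V) = 3) :
    LinearIndependent ℂ ![v a, v b, v c] := by
  have hs : Submodule.span ℂ (Set.range ![v a, v b, v c]) =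
      (T a).submodule ⊔ (T b).submodule ⊔ (T c).submodule := by
    simp only [h.submodule_eq, ← Submodule.span_union, Matrix.range_cons, Matrix.range_empty,
      Set.union_empty, Set.union_assoc]
  rw [linearIndependent_iff_card_eq_finrank_span, Set.finrank, hs, hT, Fintype.card_fin]

end IsAffineLift

/-- A generic linear form avoids the finitely many nonzero differences. It turns ratios of collinear
difference vectors into ratios of numbers. -/
theorem exists_separating_dual [FiniteDimensional ℂ V] [Finite W] (v : W → V) :
    ∃ m : V →ₗ[ℂ] ℂ, ∀ w w', v w ≠ v w' → m (v w) ≠ m (v w') := by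
  obtain ⟨m, hm⟩ := Module.exists_dual_forall_apply_ne_zero (K := ℂ)
    (fun p : {p : W × W // v p.1 ≠ v p.2} => v p.1.1 - v p.1.2) (fun p => sub_ne_zero.2 p.2)
  refine ⟨m, fun w w' h => ?_⟩
  have := hm ⟨(w, w'), h⟩
  rwa [map_sub, sub_ne_zero] at this

end AffineLift

/-! ### Trivalent black vertices and existence of VRCs -/

namespace BipartiteMap

variable {G : BipartiteMap}

instance : Finite G.White := Quotient.finite _

theorem IsTrivalent.rotB_rotB_ne (hG : G.IsTrivalent) {d : G.Dart} (hd : ¬ G.IsLeg d) :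
    G.rotB (G.rotB d) ≠ d := fun h => by
  have h3 := (hG d hd).2
  rw [h] at h3
  exact (hG d hd).1 h3

theorem IsTrivalent.eq_of_black_eq (hG : G.IsTrivalent) {d e : G.Dart} (hd : ¬ G.IsLeg d)
    (h : G.rotB.SameCycle d e) : e = d ∨ e = G.rotB d ∨ e = G.rotB (G.rotB d) := by
  obtain ⟨n, rfl⟩ := h.exists_nat_pow_eq
  clear h
  induction n with
  | zero => exact .inl rfl
  | succ n ih =>
    rw [pow_succ', Perm.mul_apply]
    rcases ih with h | h | h <;> rw [h]
    · exact .inr (.inl rfl)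
    · exact .inr (.inr rfl)
    · exact .inl (hG d hd).2

theorem rotB_sameCycle (d : G.Dart) : G.rotB.SameCycle d (G.rotB d) := ⟨1, rfl⟩

theorem rotB_rotB_sameCycle (d : G.Dart) : G.rotB.SameCycle d (G.rotB (G.rotB d)) := ⟨2, rfl⟩

open Classical in
theorem IsTrivalent.sum_black {A : Type} [AddCommMonoid A] (hG : G.IsTrivalent) {d : G.Dart}
    (hd : ¬ G.IsLeg d) (g : G.Dart → A) :
    ∑ e with G.black e = G.black d, g e = g d + (g (G.rotB d) + g (G.rotB (G.rotB d))) := by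
  have : (Finset.univ.filter fun e => G.black e = G.black d) =
      {d, G.rotB d, G.rotB (G.rotB d)} := by
    ext e
    simp only [Finset.mem_filter_univ, Finset.mem_insert, Finset.mem_singleton]
    constructor
    · intro h
      exact hG.eq_of_black_eq hd (black_eq.1 h.symm)
    · rintro (rfl | rfl | rfl)
      · rfl
      · exact (black_eq.2 (rotB_sameCycle d)).symm
      · exact (black_eq.2 (rotB_rotB_sameCycle d)).symm
  rw [this, Finset.sum_insert, Finset.sum_insert, Finset.sum_singleton]
  · rw [Finset.mem_singleton]
    exact fun h => (hG d hd).1 (G.rotB.injective h).symm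
  · rw [Finset.mem_insert, Finset.mem_singleton]
    rintro (h | h)
    · exact (hG d hd).1 h.symm
    · exact hG.rotB_rotB_ne hd h.symm

variable {V : Type} [AddCommGroup V] [Module ℂ V] {T : G.White → Projectivization ℂ V}
  {l m : V →ₗ[ℂ] ℂ} {v : G.White → V}

theorem IsTCDMap.exists_sub_eq_smul (hT : G.IsTCDMap T) (hv : IsAffineLift T l v) {d : G.Dart}
    (hd : ¬ G.IsLeg d) (hd' : G.rotB d ≠ d) : ∃ α : ℂ,
      v (G.white (G.rotB d)) - v (G.white (G.rotB (G.rotB d))) =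
        α • (v (G.white d) - v (G.white (G.rotB d))) := by
  obtain ⟨L, hL, hLe⟩ := hT.collinear d hd
  exact hv.exists_sub_eq_smul hL (hLe _ rfl) (hLe _ (black_eq.2 (rotB_sameCycle d)))
    (hLe _ (black_eq.2 (rotB_rotB_sameCycle d)))
    (hT.distinct _ _ hd (black_eq.2 (rotB_sameCycle d)) hd'.symm)

/-- Collinear affine lifts with coordinates `z₁, z₂, z₃` satisfy the relation with weights `z₂ -
z₃`, `z₃ - z₁`, `z₁ - z₂`, which are nonzero for distinct points. This serves for `T` and for its
section alike. -/
theorem IsTCDMap.exists_vrc [FiniteDimensional ℂ V] (hG : G.IsTrivalent) (hT : G.IsTCDMap T)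
    (hl : ∀ w, l (T w).rep ≠ 0) :
    ∃ R : G.VRC V, R.IsLiftOf T ∧ R.IsAffineGauge (LinearMap.ker l) := by
  classical
  obtain ⟨v, hv⟩ := exists_isAffineLift hl
  obtain ⟨m, hm⟩ := exists_separating_dual v
  refine ⟨⟨v, fun d => m (v (G.white (G.rotB d))) - m (v (G.white (G.rotB (G.rotB d)))),
    hv.ne_zero, fun d hd => ?_, fun d hd => ?_⟩, hv.mk_eq, l, rfl, hv.eq_one⟩
  · refine sub_ne_zero.2 (hm _ _ (hv.ne (hT.distinct _ _ ?_ (black_eq.2 (rotB_sameCycle _)) ?_)))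
    · rwa [isLeg_rotB_iff]
    · exact fun h => (hG d hd).1 (G.rotB.injective h).symm
  · rw [hG.sum_black hd]
    simp only [(hG d hd).2]
    obtain ⟨α, hα⟩ := hT.exists_sub_eq_smul hv hd (hG d hd).1
    rw [sub_eq_iff_eq_add'] at hα
    have h1 : v (G.white (G.rotB (G.rotB d))) =
        v (G.white (G.rotB d)) - α • (v (G.white d) - v (G.white (G.rotB d))) :=
      eq_sub_of_add_eq hα.symm
    rw [h1, map_sub, map_smul, map_sub, smul_eq_mul]
    module

end BipartiteMap

/-! ### The star graph -/

namespace BipartiteMap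

variable (G : BipartiteMap)

theorem starMap_isLeg_iff (e : G.Dart ⊕ {d : G.Dart // G.IsLeg d}) :
    G.starMap.IsLeg e ↔ ∃ d, e = .inr d := by
  have hpow : ∀ n : ℕ, ∃ h : G.IsLeg ((G.rotB ^ n) G.root),
      (G.starRotB ^ n) (.inr ⟨G.root, Perm.SameCycle.refl _ _⟩) =
        .inr ⟨(G.rotB ^ n) G.root, h⟩ := by
    intro n
    induction n with
    | zero => exact ⟨Perm.SameCycle.refl _ _, rfl⟩
    | succ n ih =>
      obtain ⟨h, hn⟩ := ih
      refine ⟨by rwa [pow_succ', Perm.mul_apply, isLeg_rotB_iff], ?_⟩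
      rw [pow_succ', Perm.mul_apply, hn]
      exact congrArg Sum.inr (Subtype.ext (DFunLike.congr_fun (pow_succ' G.rotB n) G.root).symm)
  constructor
  · intro h
    obtain ⟨n, hn⟩ := Perm.SameCycle.exists_nat_pow_eq
      (show G.starRotB.SameCycle (.inr ⟨G.root, Perm.SameCycle.refl _ _⟩) e from h)
    obtain ⟨hl, h2⟩ := hpow n
    exact ⟨_, hn.symm.trans h2⟩
  · rintro ⟨⟨d, hd⟩, rfl⟩
    obtain ⟨n, rfl⟩ := Perm.SameCycle.exists_nat_pow_eq hd
    obtain ⟨hl, h2⟩ := hpow n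
    exact ⟨n, by rw [zpow_natCast]; exact h2⟩

theorem starMap_not_isLeg_inl (d : G.Dart) : ¬ G.starMap.IsLeg (.inl d) := by
  rw [starMap_isLeg_iff]
  simp

theorem starRotW_inl_of_isLeg {d : G.Dart} (hd : G.IsLeg d) :
    G.starRotW (.inl d) = .inr ⟨d, hd⟩ := by
  simp [starRotW, hd]

theorem starRotW_inl_of_not_isLeg {d : G.Dart} (hd : ¬ G.IsLeg d) :
    G.starRotW (.inl d) = .inl (G.rotB d) := by
  simp [starRotW, hd]

theorem starLabel_starRotW_inl (d : G.Dart) :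
    G.starLabel (G.starRotW (.inl d)) = G.white (G.rotB d) := by
  by_cases hd : G.IsLeg d
  · rw [starRotW_inl_of_isLeg G hd]
    rfl
  · rw [starRotW_inl_of_not_isLeg G hd]
    rfl

open Classical in
/-- The number of black corners whose next white vertex is `u` and whose previous one is `v`. -/
noncomputable def cornerCount (u v : G.White) : ℤ :=
  ∑ d : G.Dart, if G.white (G.rotB d) = u ∧ G.white d = v then 1 else 0

theorem starMap_face_inr (d : {d : G.Dart // G.IsLeg d}) :
    G.starMap.face (.inr d) = G.starMap.face (.inl (G.rotB d.1)) :=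
  (G.starGraph.face_rotW_rotB (.inr d)).symm

/-- Walking around a face of the star graph amounts to turning around a white vertex of `G`, with a
detour through a leg `inr` at each boundary segment. -/
theorem starMap_face_inl (d : G.Dart) :
    G.starMap.face (.inl (G.rotW d)) = G.starMap.face (.inl d) := by
  have h1 : G.starMap.face (G.starRotW (.inl (G.faceRot (G.rotW d)))) =
      G.starMap.face (.inl (G.rotW d)) :=
    G.starGraph.face_rotW_rotB (.inl (G.rotW d))
  have h2 : G.rotB (G.faceRot (G.rotW d)) = d := by simp [faceRot]
  rw [← h1]
  by_cases hl : G.IsLeg (G.faceRot (G.rotW d))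
  · rw [starRotW_inl_of_isLeg G hl, starMap_face_inr, h2]
  · rw [starRotW_inl_of_not_isLeg G hl, h2]

theorem sum_sum_type_eq {A B : Type} [Fintype A] [Fintype B] {i : Fintype (A ⊕ B)}
    (g : A ⊕ B → ℤ) :
    (@Finset.univ _ i).sum g = ∑ a, g (.inl a) + ∑ b, g (.inr b) := by
  rw [Subsingleton.elim i (instFintypeSum A B)]
  exact Fintype.sum_sum_type g

/-- The edge `inl d` has `white (rotB d)` on its right and `white d` on its left, so its arrow is
the affine arrow of the dart `rotB d`. Corners at `∞` give the arrows between consecutive boundary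
vertices. -/
theorem starGraph_hasDualQuiver : G.starGraph.HasDualQuiver G.IsBoundaryWhite
    fun u v => G.cornerCount u v - G.cornerCount v u := by
  classical
  have hcount : ∀ u v, G.starGraph.arrowCount u v = G.cornerCount u v := by
    intro u v
    unfold LabelledMap.arrowCount
    have hsum : ∀ g : G.starGraph.Dart → ℤ,
        ∑ e, g e = ∑ d : G.Dart, g (.inl d) + ∑ d : {d : G.Dart // G.IsLeg d}, g (.inr d) := by
      exact fun g => sum_sum_type_eq (i := G.starGraph.fintypeDart) g
    rw [hsum]
    have h0 : ∀ d : {d : G.Dart // G.IsLeg d}, G.starGraph.IsLeg (.inr d) := fun d =>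
      (G.starMap_isLeg_iff _).2 ⟨d, rfl⟩
    rw [Finset.sum_eq_zero (s := Finset.univ (α := {d : G.Dart // G.IsLeg d}))
      (fun d _ => if_neg fun h => h.1 (h0 d)), add_zero]
    refine Finset.sum_congr rfl fun d _ => ?_
    refine if_congr ?_ rfl rfl
    change ¬ G.starMap.IsLeg (.inl d) ∧ G.starLabel (G.starRotW (.inl d)) = u ∧ G.white d = v ↔ _
    rw [starLabel_starRotW_inl]
    simp only [starMap_not_isLeg_inl, not_false_eq_true, true_and]
  have hrep : ∀ e : G.starGraph.Dart, ∃ d : G.Dart,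
      G.starGraph.face e = G.starGraph.face (.inl d) ∧ G.starGraph.label e = G.white d := by
    rintro (d | d)
    · exact ⟨d, rfl, rfl⟩
    · exact ⟨G.rotB d.1, G.starMap_face_inr d, rfl⟩
  refine ⟨fun e e' h => ?_, fun w => ?_, fun w => ?_, fun u v => ?_⟩
  · obtain ⟨d, hd, hl⟩ := hrep e
    obtain ⟨d', hd', hl'⟩ := hrep e'
    rw [hl, hl', white_eq] at h
    rw [hd, hd']
    obtain ⟨n, rfl⟩ := h.exists_nat_pow_eq
    clear h hd' hl'
    induction n with
    | zero => rfl
    | succ n ih =>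
      rw [pow_succ', Perm.mul_apply, ih]
      exact (G.starMap_face_inl _).symm
  · induction w using Quotient.inductionOn with | h d => exact ⟨.inl d, rfl⟩
  · constructor
    · rintro ⟨e, he, rfl⟩
      obtain ⟨d, rfl⟩ := (G.starMap_isLeg_iff e).1 he
      exact ⟨G.rotB d.1, (G.isLeg_rotB_iff _).2 d.2, rfl⟩
    · rintro ⟨d, hd, rfl⟩
      refine ⟨.inr ⟨G.rotB⁻¹ d, (G.isLeg_rotB_inv_iff d).2 hd⟩,
        (G.starMap_isLeg_iff _).2 ⟨_, rfl⟩, ?_⟩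
      change G.white (G.rotB (G.rotB⁻¹ d)) = _
      rw [perm_apply_inv_self]
  · rw [hcount, hcount]

variable {G} {V : Type} [AddCommGroup V] [Module ℂ V] {T : G.White → Projectivization ℂ V}
  {l m : V →ₗ[ℂ] ℂ} {v : G.White → V}

theorem starGraph_sameCycle_inl {d d' : G.Dart}
    (h : G.starGraph.rotB.SameCycle (.inl d) (.inl d')) : G.face d = G.face d' := by
  obtain ⟨n, hn⟩ := h.exists_nat_pow_eq
  have hpow : ∀ n : ℕ, (G.starRotB ^ n) (.inl d) = .inl ((G.faceRot ^ n) d) := by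
    intro n
    induction n with
    | zero => rfl
    | succ n ih =>
      rw [pow_succ', Perm.mul_apply, ih, pow_succ']
      rfl
  have := (hpow n).symm.trans hn
  exact face_eq.2 ⟨n, by rw [zpow_natCast]; exact Sum.inl_injective this⟩

theorem starGraph_label_rotW_inl (d : G.Dart) :
    G.starGraph.label (G.starGraph.rotW (.inl d)) = G.white (G.rotB d) :=
  G.starLabel_starRotW_inl d

/-- A black vertex of the star graph is a face of `G`. By minimality its different darts end at
different white vertices, so 1-genericity applies to any three of them. -/
theorem starGraph_triplesSatisfy (hG : G.IsPlanar) (hmin : G.IsMinimal) (hT1 : G.IsOneGeneric T)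
    (hv : IsAffineLift T l v) :
    G.starGraph.TriplesSatisfy fun a b c => LinearIndependent ℂ ![v a, v b, v c] := by
  have hinj : ∀ {d d'}, G.face d = G.face d' → d ≠ d' → G.white d ≠ G.white d' :=
    fun hf hne hw => hne (hmin.eq_of_face_eq_of_white_eq hG hf hw)
  have hr : ∀ e : G.starGraph.Dart, ¬ G.starGraph.IsLeg e → ∃ d : G.Dart, e = .inl d := by
    rintro (d | d) he
    · exact ⟨d, rfl⟩
    · exact absurd ((G.starMap_isLeg_iff _).2 ⟨d, rfl⟩) he
  intro e₁ e₂ e₃ h0 h12 h13 n12 n23 n13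
  have hlegs : ∀ e, G.starGraph.rotB.SameCycle e₁ e → ¬ G.starGraph.IsLeg e :=
    fun e he h => h0 (h.trans he.symm)
  obtain ⟨d₁, rfl⟩ := hr _ h0
  obtain ⟨d₂, rfl⟩ := hr _ (hlegs _ h12)
  obtain ⟨d₃, rfl⟩ := hr _ (hlegs _ h13)
  have f12 := starGraph_sameCycle_inl h12
  have f13 := starGraph_sameCycle_inl h13
  have f23 := f12.symm.trans f13
  exact hv.linearIndependent (hT1.plane d₁ d₂ d₃ f12 f23
    (hinj f12 fun h => n12 (by rw [h])) (hinj f23 fun h => n23 (by rw [h]))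
    (hinj f13 fun h => n13 (by rw [h])))

theorem IsTCDMap.ne_rotB (hG : G.IsTrivalent) (hT : G.IsTCDMap T) (hv : IsAffineLift T l v)
    (hm : ∀ w w', v w ≠ v w' → m (v w) ≠ m (v w')) {d : G.Dart} (hd : ¬ G.IsLeg d) :
    m (v (G.white d)) ≠ m (v (G.white (G.rotB d))) :=
  hm _ _ (hv.ne (hT.distinct _ _ hd (black_eq.2 (rotB_sameCycle d)) (hG d hd).1.symm))

theorem IsOneGeneric.ne_rotB (hT : G.IsTCDMap T) (hT1 : G.IsOneGeneric T)
    (hv : IsAffineLift T l v) (hm : ∀ w w', v w ≠ v w' → m (v w) ≠ m (v w')) {d : G.Dart}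
    (hd : G.white d ≠ G.white (G.rotB d)) :
    m (v (G.white d)) ≠ m (v (G.white (G.rotB d))) := by
  refine hm _ _ (hv.ne ?_)
  by_cases hl : G.IsLeg d
  · exact hT1.boundary d hl hd
  · exact hT.distinct _ _ hl (black_eq.2 (rotB_sameCycle d)) fun h => hd (by rw [← h])

/-- At a black vertex of `G` the three points are collinear, so the normalized differences agree. At
a boundary segment there are only two faces, and exchanging them changes the sign of both sides. -/
theorem starGraph_hasDirections (hG : G.IsTrivalent) (hT : G.IsTCDMap T)
    (hT1 : G.IsOneGeneric T) (hv : IsAffineLift T l v)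
    (hm : ∀ w w', v w ≠ v w' → m (v w) ≠ m (v w')) :
    G.starGraph.HasDirections v fun w => m (v w) := by
  obtain ⟨u, hu, hu'⟩ : ∃ u : G.Dart → V,
      (∀ d, v (G.white d) - v (G.white (G.rotB d)) =
        (m (v (G.white d)) - m (v (G.white (G.rotB d)))) • u d) ∧
      ∀ d, ¬ G.IsLeg d → u (G.rotB d) = u d := by
    refine ⟨fun d => (m (v (G.white d)) - m (v (G.white (G.rotB d))))⁻¹ •
      (v (G.white d) - v (G.white (G.rotB d))), fun d => ?_, fun d hd => ?_⟩
    -- For glued boundary vertices the inverse is `0⁻¹ = 0` and both sides vanish.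
    · by_cases hd : G.white d = G.white (G.rotB d)
      · rw [← hd, sub_self, sub_self, zero_smul]
      · rw [smul_smul, mul_inv_cancel₀ (sub_ne_zero.2 (hT1.ne_rotB hT hv hm hd)), one_smul]
    -- The next difference is `α` times the present one, and so is its `m`-value; the factor cancels
    -- in the normalization.
    · obtain ⟨α, hα⟩ := hT.exists_sub_eq_smul hv hd (hG d hd).1
      have hα0 : α ≠ 0 := by
        rintro rfl
        refine hT.ne_rotB hG hv hm (d := G.rotB d) (by rwa [isLeg_rotB_iff]) ?_
        rw [zero_smul, sub_eq_zero] at hα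
        rw [hα]
      have hmα := congrArg m hα
      rw [map_sub, map_smul, map_sub, smul_eq_mul] at hmα
      beta_reduce
      rw [hα, hmα, smul_smul, mul_inv, mul_right_comm, inv_mul_cancel₀ hα0, one_mul]
  refine ⟨Sum.elim u fun d => u d.1, ?_, ?_⟩
  · rintro (d | d)
    · by_cases hd : G.IsLeg d
      · have h1 : G.starGraph.rotW (.inl d) = .inr ⟨d, hd⟩ := G.starRotW_inl_of_isLeg hd
        rw [h1, Sum.elim_inr, Sum.elim_inl]
      · have h1 : G.starGraph.rotW (.inl d) = .inl (G.rotB d) := G.starRotW_inl_of_not_isLeg hd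
        rw [h1, Sum.elim_inl, Sum.elim_inl, hu' d hd]
    · rfl
  · rintro (d | d)
    · rw [starGraph_label_rotW_inl]
      exact hu d
    · change v (G.white (G.rotB d.1)) - v (G.white d.1) =
        (m (v (G.white (G.rotB d.1))) - m (v (G.white d.1))) • u d.1
      rw [← neg_sub, hu, ← neg_sub (m (v (G.white d.1))), neg_smul]

/-- If `d` and `rotB d` have the same white end, then `d` and `rotW (rotB d)` share a face and a
white vertex, so they coincide. The face then consists of the single dart `d` and gives a black leaf
of the star graph. -/
theorem starGraph_separatedUpToLeaves (hG : G.IsPlanar) (hmin : G.IsMinimal) (hT : G.IsTCDMap T)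
    (hT1 : G.IsOneGeneric T) (hv : IsAffineLift T l v)
    (hm : ∀ w w', v w ≠ v w' → m (v w) ≠ m (v w')) :
    G.starGraph.SeparatedUpToLeaves fun w => m (v w) := by
  have hleaf : ∀ d, G.white d = G.white (G.rotB d) → G.starRotB (.inl d) = .inl d := by
    intro d hd
    refine congrArg Sum.inl ?_
    have hf : G.face (G.rotW (G.rotB d)) = G.face d := by
      rw [face_eq, sameCycle_faceRot_iff]
      exact Perm.sameCycle_apply_left.2 (Perm.SameCycle.refl _ _)
    have h1 := hmin.eq_of_face_eq_of_white_eq hG hf (by rw [G.white_rotW, hd])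
    rw [faceRot_eq_inv, Perm.inv_eq_iff_eq]
    exact h1.symm
  rintro (d | d)
  · rw [starGraph_label_rotW_inl]
    by_cases hd : G.white d = G.white (G.rotB d)
    · exact .inr (.inl ⟨G.starMap_not_isLeg_inl d, hleaf d hd⟩)
    · exact .inl (hT1.ne_rotB hT hv hm hd)
  · by_cases hd : G.white d.1 = G.white (G.rotB d.1)
    · exact .inr (.inr ⟨G.starMap_not_isLeg_inl d.1, hleaf d.1 hd⟩)
    · exact .inl (hT1.ne_rotB hT hv hm hd).symm

/-- The star graph of a `1`-generic TCD map on a minimal graph. -/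
theorem starGraph_compatible (hG : G.IsBTB) (hmin : G.IsMinimal) (hT : G.IsTCDMap T)
    (hT1 : G.IsOneGeneric T) (hv : IsAffineLift T l v)
    (hm : ∀ w w', v w ≠ v w' → m (v w) ≠ m (v w')) :
    G.starGraph.Compatible G.IsBoundaryWhite
      (fun u v => G.cornerCount u v - G.cornerCount v u)
      (fun a b c => LinearIndependent ℂ ![v a, v b, v c]) v (fun w => m (v w)) where
  dualQuiver := G.starGraph_hasDualQuiver
  triples := starGraph_triplesSatisfy hG.planar hmin hT1 hv
  directions := starGraph_hasDirections hG.trivalent hT hT1 hv hm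

end BipartiteMap

/-! ### Arrow counts and the affine cluster variables -/

theorem finset_map_count {D W : Type} [DecidableEq W] (s : Finset D) (f : D → W) (u : W) :
    (s.val.map f).count u = (s.filter fun d => f d = u).card := by
  rw [Multiset.count_map, Finset.card_def, Finset.filter_val]
  simp only [eq_comm]

/-- Quotients of products depend only on the differences of the multiplicities of the factors. -/
theorem prod_div_prod_eq {D E W : Type} {s s' : Finset D} {t t' : Finset E} {f f' : D → W}
    {k k' : E → W} {g : W → ℂ} (hs' : ∀ d ∈ s', g (f' d) ≠ 0) (ht' : ∀ d ∈ t', g (k' d) ≠ 0)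
    (h : ∀ u, by classical exact
      ((s.filter fun d => f d = u).card : ℤ) - (s'.filter fun d => f' d = u).card =
        (t.filter fun d => k d = u).card - (t'.filter fun d => k' d = u).card) :
    (∏ d ∈ s, g (f d)) / ∏ d ∈ s', g (f' d) = (∏ d ∈ t, g (k d)) / ∏ d ∈ t', g (k' d) := by
  classical
  -- After cross-multiplication the hypothesis says that the two multisets of factors are equal.
  have key : s.val.map f + t'.val.map k' = t.val.map k + s'.val.map f' := by
    ext u
    have := h u
    simp only [Multiset.count_add, finset_map_count]
    omega
  have hp := congrArg (fun p : Multiset W => (p.map g).prod) key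
  simp only [Multiset.map_add, Multiset.prod_add, Multiset.map_map] at hp
  rw [div_eq_div_iff (Finset.prod_ne_zero_iff.2 hs') (Finset.prod_ne_zero_iff.2 ht')]
  exact hp

namespace LabelledMap

variable {W : Type} {S : LabelledMap W}

open Classical in
theorem arrowCount_eq_card (S : LabelledMap W) (u v : W) : S.arrowCount u v =
    (Finset.univ.filter fun d => ¬ S.IsLeg d ∧ S.label (S.rotW d) = u ∧ S.label d = v).card := by
  unfold arrowCount
  rw [Finset.sum_boole]

variable {b : W → Prop} {q : W → W → ℤ}

/-- The faces of `S` are identified with their labels. -/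
noncomputable def HasDualQuiver.faceEquiv (h : S.HasDualQuiver b q) : S.Face ≃ W :=
  Equiv.ofBijective (Quotient.lift S.label fun _ _ hee =>
      label_eq_of_face_eq (BipartiteMap.face_eq.2 hee)) (by
    constructor
    · intro f g
      induction f using Quotient.inductionOn with
      | h e => induction g using Quotient.inductionOn with | h e' => exact h.face_eq e e'
    · intro w
      obtain ⟨e, rfl⟩ := h.surjective w
      exact ⟨S.face e, rfl⟩)

theorem HasDualQuiver.faceEquiv_face (h : S.HasDualQuiver b q) (e : S.Dart) :
    h.faceEquiv (S.face e) = S.label e := rfl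

theorem HasDualQuiver.face_eq_iff (h : S.HasDualQuiver b q) (e : S.Dart) (f : S.Face) :
    S.face e = f ↔ S.label e = h.faceEquiv f := by
  rw [← h.faceEquiv_face, h.faceEquiv.injective.eq_iff]

theorem HasDualQuiver.isBoundaryFace_iff (h : S.HasDualQuiver b q) (f : S.Face) :
    S.IsBoundaryFace f ↔ b (h.faceEquiv f) := by
  simp only [← h.frozen, BipartiteMap.IsBoundaryFace, h.face_eq_iff]

theorem HasDualQuiver.card_arrows (h : S.HasDualQuiver b q) (f g : S.Face) :
    (Nat.card {i : {d : S.Dart // ¬ S.IsLeg d} // S.face (S.rotB⁻¹ i.1) = f ∧ S.face i.1 = g} : ℤ) =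
      S.arrowCount (h.faceEquiv f) (h.faceEquiv g) := by
  classical
  rw [arrowCount_eq_card, Nat.cast_inj, ← Fintype.card_subtype, ← Nat.card_eq_fintype_card]
  refine Nat.card_congr ((Equiv.subtypeSubtypeEquivSubtypeInter _
    (fun d => S.face (S.rotB⁻¹ d) = f ∧ S.face d = g)).trans (Equiv.subtypeEquivRight fun d => ?_))
  rw [h.face_eq_iff, h.face_eq_iff, label_rotW]

end LabelledMap

namespace BipartiteMap

variable {G : BipartiteMap}

open Classical in
theorem cornerCount_eq_card (u v : G.White) : G.cornerCount u v =
    (Finset.univ.filter fun d => G.white (G.rotB d) = u ∧ G.white d = v).card := by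
  unfold cornerCount
  rw [Finset.sum_boole]

theorem card_affArrows (u v : G.White) :
    (Nat.card {d : G.Dart // G.white d = u ∧ G.white (G.rotB⁻¹ d) = v} : ℤ) =
      G.cornerCount u v := by
  classical
  rw [cornerCount_eq_card, Nat.cast_inj, ← Fintype.card_subtype, ← Nat.card_eq_fintype_card]
  refine (Nat.card_congr (G.rotB.subtypeEquiv fun d => ?_)).symm
  rw [perm_inv_apply_self]

variable {V : Type} [AddCommGroup V] [Module ℂ V] {T : G.White → Projectivization ℂ V}
  {l m : V →ₗ[ℂ] ℂ} {v : G.White → V}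

/-- Any vector-relation configuration in affine gauge is a multiple of a given affine lift. -/
theorem VRC.exists_vec_eq_smul {R : G.VRC V} (hR : R.IsLiftOf T)
    (hH : R.IsAffineGauge (LinearMap.ker l)) (hv : IsAffineLift T l v) :
    ∃ κ : ℂ, κ ≠ 0 ∧ ∀ w, R.vec w = κ • v w := by
  obtain ⟨l', hl', h1⟩ := hH
  let w₀ := G.white G.root
  -- The gauge form `l'` need not be `l`, but it has the same kernel and hence is constant on the
  -- lifts.
  have hconst : ∀ w, l' (v w) = l' (v w₀) := by
    intro w
    have : v w - v w₀ ∈ LinearMap.ker l' := by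
      rw [hl', LinearMap.mem_ker, map_sub, hv.eq_one, hv.eq_one, sub_self]
    rwa [LinearMap.mem_ker, map_sub, sub_eq_zero] at this
  have hne : l' (v w₀) ≠ 0 := by
    intro h0
    have : v w₀ ∈ LinearMap.ker l := by rw [← hl', LinearMap.mem_ker, h0]
    rw [LinearMap.mem_ker, hv.eq_one] at this
    exact one_ne_zero this
  refine ⟨(l' (v w₀))⁻¹, inv_ne_zero hne, fun w => ?_⟩
  have h2 := (hR w).trans (hv.mk_eq w).symm
  rw [Projectivization.mk_eq_mk_iff'] at h2
  obtain ⟨a, ha⟩ := h2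
  have h3 := h1 w
  rw [← ha, map_smul, hconst, smul_eq_mul] at h3
  rw [← ha, eq_inv_of_mul_eq_one_left h3]

open Classical in
/-- The affine cluster variable in terms of an affine coordinate. -/
theorem VRC.affVar_eq (hG : G.IsTrivalent) (hT : G.IsTCDMap T) {R : G.VRC V}
    (hR : R.IsLiftOf T) (hH : R.IsAffineGauge (LinearMap.ker l)) (hv : IsAffineLift T l v)
    (hm : ∀ w w', v w ≠ v w' → m (v w) ≠ m (v w')) {w : G.White} (hw : ¬ G.IsBoundaryWhite w) :
    R.affVar w = -((∏ d with G.white d = w, (m (v w) - m (v (G.white (G.rotB d))))) /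
      ∏ d with G.white d = w, (m (v w) - m (v (G.white (G.rotB⁻¹ d))))) := by
  obtain ⟨κ, hκ, hvec⟩ := VRC.exists_vec_eq_smul hR hH hv
  -- Eliminating the weight of `d` from `∑ μ = 0` and `∑ μ z = 0` gives the ratio of the other two.
  -- The `m` signs produced here combine with `(-1)^(m+1)`, for `m` edges at `w`, to `-1`.
  have hfac : ∀ d ∈ Finset.univ.filter fun d => G.white d = w,
      R.wt (G.rotB (G.rotB d)) / R.wt (G.rotB d) =
        -1 * ((m (v w) - m (v (G.white (G.rotB d)))) /
          (m (v w) - m (v (G.white (G.rotB⁻¹ d))))) := by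
    intro d hd
    obtain rfl : G.white d = w := (Finset.mem_filter.1 hd).2
    have hl : ¬ G.IsLeg d := fun h => hw ⟨d, h, rfl⟩
    have hinv : G.rotB⁻¹ d = G.rotB (G.rotB d) := by
      rw [Perm.inv_eq_iff_eq, (hG d hl).2]
    have h0 := hH.sum_wt d hl
    have h1 := congrArg m (R.relation d hl)
    rw [hG.sum_black hl] at h0 h1
    simp only [hvec, map_add, map_smul, smul_eq_mul, map_zero] at h1
    have h2 : m (v (G.white d)) - m (v (G.white (G.rotB (G.rotB d)))) ≠ 0 :=
      sub_ne_zero.2 (hm _ _ (hv.ne (hT.distinct _ _ hl (black_eq.2 (rotB_rotB_sameCycle d))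
        (hG.rotB_rotB_ne hl).symm)))
    have h3 : R.wt (G.rotB d) ≠ 0 := R.wt_ne_zero _ (by rwa [isLeg_rotB_iff])
    rw [hinv]
    field_simp
    have h4 : κ * (R.wt (G.rotB (G.rotB d)) * (m (v (G.white d)) -
        m (v (G.white (G.rotB (G.rotB d))))) + R.wt (G.rotB d) * (m (v (G.white d)) -
        m (v (G.white (G.rotB d))))) = 0 := by
      linear_combination (κ * m (v (G.white d))) * h0 - h1
    have h5 := (mul_eq_zero.1 h4).resolve_left hκ
    linear_combination h5
  rw [VRC.affVar, Finset.prod_congr rfl hfac, Finset.prod_mul_distrib, Finset.prod_const,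
    Finset.prod_div_distrib, ← mul_assoc, ← pow_add]
  have : (-1 : ℂ) ^ ((Finset.univ.filter fun d => G.white d = w).card + 1 +
      (Finset.univ.filter fun d => G.white d = w).card) = -1 := by
    rw [Odd.neg_one_pow]
    exact ⟨(Finset.univ.filter fun d => G.white d = w).card, by ring⟩
  rw [this, neg_one_mul]

end BipartiteMap

/-! ### The section map and its cluster variables -/

namespace LabelledMap

variable {W V : Type} [AddCommGroup V] [Module ℂ V]

theorem finrank_span_pair {x y : V} (h : LinearIndependent ℂ ![x, y]) :
    Module.finrank ℂ (Submodule.span ℂ {x, y}) = 2 := by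
  rw [show ({x, y} : Set V) = Set.range ![x, y] by simp [Set.pair_comm], finrank_span_eq_card h,
    Fintype.card_fin]

/-- `u` gives the directions in `ker l` of the lines at the white vertices of `S`, normalized by
`m`, in a generic situation. -/
structure IsDirection (S : LabelledMap W) (l m : V →ₗ[ℂ] ℂ) (v : W → V)
    (u : S.Dart → LinearMap.ker l) : Prop where
  trivalent : S.IsTrivalent
  triples : S.TriplesSatisfy fun a b c => LinearIndependent ℂ ![v a, v b, v c]
  separated : S.Separated fun w => m (v w)
  apply_rotW : ∀ e, u (S.rotW e) = u e
  sub_eq : ∀ e, v (S.label e) - v (S.label (S.rotW e)) =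
    (m (v (S.label e)) - m (v (S.label (S.rotW e)))) • (u e : V)

/-- Applying `l` to a difference of lifts gives zero, and by separation the coefficient of the
direction is nonzero, so the directions lie in `ker l`. -/
theorem exists_isDirection {S : LabelledMap W} {b : W → Prop} {q : W → W → ℤ} {l m : V →ₗ[ℂ] ℂ}
    {v : W → V} (hl : ∀ w, l (v w) = 1) (hS : S.IsTrivalent)
    (h : S.Compatible b q (fun a b c => LinearIndependent ℂ ![v a, v b, v c]) v
      fun w => m (v w)) (hz : S.Separated fun w => m (v w)) :
    ∃ u, S.IsDirection l m v u := by
  obtain ⟨u, hu, huv⟩ := h.directions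
  refine ⟨fun e => ⟨u e, ?_⟩, hS, h.triples, hz, fun e => Subtype.ext (hu e), huv⟩
  have h1 := congrArg l (huv e)
  rw [map_sub, map_smul, hl, hl, sub_self, smul_eq_mul] at h1
  exact (mul_eq_zero.1 h1.symm).resolve_left (sub_ne_zero.2 (hz e))

namespace IsDirection

variable {S : LabelledMap W} {l m : V →ₗ[ℂ] ℂ} {v : W → V} {u : S.Dart → LinearMap.ker l}

theorem ne_zero (h : S.IsDirection l m v u) (e : S.Dart) : u e ≠ 0 := by
  intro h0
  have h1 := congrArg m (h.sub_eq e)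
  rw [h0, ZeroMemClass.coe_zero, smul_zero, map_zero, map_sub] at h1
  exact h.separated e (sub_eq_zero.1 h1)

theorem eq_of_white_eq (h : S.IsDirection l m v u) {e e' : S.Dart} (he : S.white e = S.white e') :
    u e = u e' := by
  obtain ⟨n, rfl⟩ := (BipartiteMap.white_eq.1 he).exists_nat_pow_eq
  clear he
  induction n with
  | zero => rfl
  | succ n ih => rw [pow_succ', Perm.mul_apply, h.apply_rotW, ← ih]

theorem exists_section (h : S.IsDirection l m v u) :
    ∃ t : S.White → Projectivization ℂ (LinearMap.ker l),
      ∀ e, t (S.white e) = Projectivization.mk ℂ (u e) (h.ne_zero e) := by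
  refine ⟨Quotient.lift (fun e => Projectivization.mk ℂ (u e) (h.ne_zero e)) ?_, fun e => rfl⟩
  intro e e' hee
  have := h.eq_of_white_eq (BipartiteMap.white_eq.2 hee)
  simp only [this]

theorem spanAt_eq {T : W → Projectivization ℂ V} (h : S.IsDirection l m v u)
    (hv : IsAffineLift T l v) (e : S.Dart) :
    S.spanAt T (S.white e) = Submodule.span ℂ {v (S.label e), (u e : V)} := by
  refine le_antisymm (iSup_le ?_) ?_
  · rintro ⟨e', he'⟩
    rw [hv.submodule_eq, Submodule.span_singleton_le_iff_mem]
    obtain ⟨n, rfl⟩ := (BipartiteMap.white_eq.1 he'.symm).exists_nat_pow_eq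
    change v (S.label ((S.rotW ^ n) e)) ∈ _
    clear he'
    induction n with
    | zero => exact Submodule.subset_span (by simp)
    | succ n ih =>
      rw [pow_succ', Perm.mul_apply]
      have h1 := h.sub_eq ((S.rotW ^ n) e)
      have h2 : u ((S.rotW ^ n) e) = u e := (h.eq_of_white_eq (BipartiteMap.white_eq.2
        (Perm.sameCycle_pow_right.2 (Perm.SameCycle.refl _ _)))).symm
      rw [sub_eq_iff_eq_add', h2, ← sub_eq_iff_eq_add] at h1
      rw [← h1]
      exact sub_mem ih (Submodule.smul_mem _ _ (Submodule.subset_span (by simp)))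
  · have hmem : ∀ e', S.white e' = S.white e → v (S.label e') ∈ S.spanAt T (S.white e) := by
      intro e' he'
      have h1 : (T (S.label e')).submodule ≤ S.spanAt T (S.white e) :=
        le_iSup (fun d : {d // S.white d = S.white e} => (T (S.label d.1)).submodule) ⟨e', he'⟩
      rw [hv.submodule_eq, Submodule.span_singleton_le_iff_mem] at h1
      exact h1
    rw [Submodule.span_le]
    rintro x (rfl | rfl)
    · exact hmem e rfl
    · have h1 := sub_mem (hmem e rfl) (hmem (S.rotW e) (S.white_rotW e))
      rw [h.sub_eq] at h1
      exact (Submodule.smul_mem_iff _ (sub_ne_zero.2 (h.separated e))).1 h1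

/-- The span is generated by a lift, on which `l` is `1`, and the direction, on which `l` is `0`;
only multiples of the latter lie in `ker l`. -/
theorem isSectionMap {T : W → Projectivization ℂ V} (h : S.IsDirection l m v u)
    (hv : IsAffineLift T l v) {t : S.White → Projectivization ℂ (LinearMap.ker l)}
    (ht : ∀ e, t (S.white e) = Projectivization.mk ℂ (u e) (h.ne_zero e)) :
    S.IsSectionMap T (LinearMap.ker l) t := by
  intro s
  induction s using Quotient.inductionOn with
  | h e =>
  change Module.finrank ℂ (S.spanAt T (S.white e)) = 2 ∧
    (t (S.white e)).submodule.map (LinearMap.ker l).subtype =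
      S.spanAt T (S.white e) ⊓ LinearMap.ker l
  have hne : (u e : V) ≠ 0 := fun h0 => h.ne_zero e (Subtype.ext h0)
  have hlu : l (u e : V) = 0 := (u e).2
  rw [ht, h.spanAt_eq hv, Projectivization.submodule_mk, Submodule.map_span, Set.image_singleton,
    Submodule.subtype_apply]
  constructor
  · have hli : LinearIndependent ℂ ![v (S.label e), (u e : V)] := by
      rw [LinearIndependent.pair_iff]
      intro α β hαβ
      have h1 := congrArg l hαβ
      rw [map_add, map_smul, map_smul, hv.eq_one, hlu, smul_zero, add_zero, smul_eq_mul, mul_one,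
        map_zero] at h1
      rw [h1, zero_smul, zero_add, smul_eq_zero] at hαβ
      exact ⟨h1, hαβ.resolve_right hne⟩
    exact finrank_span_pair hli
  · refine le_antisymm ?_ ?_
    · rw [Submodule.span_singleton_le_iff_mem]
      exact ⟨Submodule.subset_span (by simp), (u e).2⟩
    · rintro x ⟨hx, hx'⟩
      obtain ⟨α, β, rfl⟩ := Submodule.mem_span_pair.1 hx
      have h1 : l (α • v (S.label e) + β • (u e : V)) = 0 := hx'
      rw [map_add, map_smul, map_smul, hv.eq_one, hlu, smul_zero, add_zero, smul_eq_mul,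
        mul_one] at h1
      rw [h1, zero_smul, zero_add]
      exact Submodule.smul_mem _ _ (Submodule.mem_span_singleton_self _)

theorem label_rotW_eq (h : S.IsDirection l m v u) {e : S.Dart} (he : ¬ S.IsLeg e) :
    S.label (S.rotW e) = S.label (S.rotB (S.rotB e)) := by
  rw [S.label_rotW, show S.rotB⁻¹ e = S.rotB (S.rotB e) by
    rw [Perm.inv_eq_iff_eq, (h.trivalent e he).2]]

/-- The points at two neighbours of a black vertex are different. -/
theorem pair_independent (h : S.IsDirection l m v u) {e : S.Dart} (he : ¬ S.IsLeg e) {α β : ℂ}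
    (hαβ : α • u e + β • u (S.rotB e) = 0) : α = 0 ∧ β = 0 := by
  have hli := h.triples e (S.rotB e) (S.rotB (S.rotB e)) he (BipartiteMap.rotB_sameCycle e)
    (BipartiteMap.rotB_rotB_sameCycle e) (h.trivalent e he).1.symm
    (fun h' => (h.trivalent e he).1 (S.rotB.injective h').symm)
    (h.trivalent.rotB_rotB_ne he).symm
  replace hli := Fintype.linearIndependent_iff.1 hli
  have h0 := h.sub_eq e
  have h1 := h.sub_eq (S.rotB e)
  have n0 := sub_ne_zero.2 (h.separated e)
  have n1 := sub_ne_zero.2 (h.separated (S.rotB e))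
  simp only [h.label_rotW_eq he, S.label_rotW_rotB] at h0 h1 n0 n1
  generalize m (v (S.label e)) - m (v (S.label (S.rotB (S.rotB e)))) = A₀ at h0 n0
  generalize m (v (S.label (S.rotB e))) - m (v (S.label e)) = A₁ at h1 n1
  have hV : α • (u e : V) + β • (u (S.rotB e) : V) = 0 := congrArg Subtype.val hαβ
  -- `A₀ A₁ (α u + β u')` written out in the three independent lifts at the corners of the triangle.
  have key := hli ![A₁ * α - A₀ * β, A₀ * β, -(A₁ * α)] (by
    rw [Fin.sum_univ_three]
    change (A₁ * α - A₀ * β) • v (S.label e) + (A₀ * β) • v (S.label (S.rotB e)) +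
      (-(A₁ * α)) • v (S.label (S.rotB (S.rotB e))) = 0
    have e1 : (A₁ * α - A₀ * β) • v (S.label e) + (A₀ * β) • v (S.label (S.rotB e)) +
        (-(A₁ * α)) • v (S.label (S.rotB (S.rotB e))) =
        (A₁ * α) • (v (S.label e) - v (S.label (S.rotB (S.rotB e)))) +
        (A₀ * β) • (v (S.label (S.rotB e)) - v (S.label e)) := by module
    have e2 : (A₁ * α) • A₀ • (u e : V) + (A₀ * β) • A₁ • (u (S.rotB e) : V) =
        (A₀ * A₁) • (α • (u e : V) + β • (u (S.rotB e) : V)) := by module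
    rw [e1, h0, h1, e2, hV, smul_zero])
  have k1 : A₀ * β = 0 := key 1
  have k2 : -(A₁ * α) = 0 := key 2
  exact ⟨(mul_eq_zero.1 (neg_eq_zero.1 k2)).resolve_left n1, (mul_eq_zero.1 k1).resolve_left n0⟩

/-- The relation between the directions at a black vertex. -/
theorem sum_eq_zero (h : S.IsDirection l m v u) {e : S.Dart} (he : ¬ S.IsLeg e) :
    (m (v (S.label e)) - m (v (S.label (S.rotW e)))) • u e +
      ((m (v (S.label (S.rotB e))) - m (v (S.label (S.rotW (S.rotB e))))) • u (S.rotB e) +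
      (m (v (S.label (S.rotB (S.rotB e)))) - m (v (S.label (S.rotW (S.rotB (S.rotB e)))))) •
        u (S.rotB (S.rotB e))) = 0 := by
  refine Subtype.ext ?_
  simp only [Submodule.coe_add, Submodule.coe_smul, ZeroMemClass.coe_zero]
  rw [← h.sub_eq, ← h.sub_eq, ← h.sub_eq, h.label_rotW_eq he, S.label_rotW_rotB,
    S.label_rotW_rotB]
  abel

/-- This is Menelaus: the directions are those of the sides of a triangle. Any two are independent,
and the three sides sum to zero. -/
theorem isTCDMap (h : S.IsDirection l m v u) {t : S.White → Projectivization ℂ (LinearMap.ker l)}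
    (ht : ∀ e, t (S.white e) = Projectivization.mk ℂ (u e) (h.ne_zero e)) : S.IsTCDMap t := by
  have hdist : ∀ e, ¬ S.IsLeg e → t (S.white e) ≠ t (S.white (S.rotB e)) := by
    intro e he heq
    rw [ht, ht, Projectivization.mk_eq_mk_iff'] at heq
    obtain ⟨a, ha⟩ := heq
    have := (h.pair_independent he (α := 1) (β := -a) (by rw [← ha]; module)).1
    exact one_ne_zero this
  refine ⟨fun d e hd hde hne => ?_, fun d hd => ?_⟩
  · rcases h.trivalent.eq_of_black_eq hd (BipartiteMap.black_eq.1 hde) with rfl | rfl | rfl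
    · exact absurd rfl hne
    · exact hdist d hd
    · have := hdist (S.rotB (S.rotB d))
        (by rwa [BipartiteMap.isLeg_rotB_iff, BipartiteMap.isLeg_rotB_iff])
      rw [(h.trivalent d hd).2] at this
      exact this.symm
  · refine ⟨Submodule.span ℂ {u d, u (S.rotB d)}, ?_, fun e hde => ?_⟩
    · have hli : LinearIndependent ℂ ![u d, u (S.rotB d)] := by
        rw [LinearIndependent.pair_iff]
        exact fun α β => h.pair_independent hd
      exact finrank_span_pair hli
    · rw [ht, Projectivization.submodule_mk, Submodule.span_singleton_le_iff_mem]
      have m0 : u d ∈ Submodule.span ℂ {u d, u (S.rotB d)} := Submodule.subset_span (by simp)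
      have m1 : u (S.rotB d) ∈ Submodule.span ℂ {u d, u (S.rotB d)} :=
        Submodule.subset_span (by simp)
      rcases h.trivalent.eq_of_black_eq hd (BipartiteMap.black_eq.1 hde) with rfl | rfl | rfl
      · exact m0
      · exact m1
      · have hs := h.sum_eq_zero hd
        rw [← add_assoc] at hs
        have hm := neg_mem (add_mem (Submodule.smul_mem _
          (m (v (S.label d)) - m (v (S.label (S.rotW d)))) m0) (Submodule.smul_mem _
          (m (v (S.label (S.rotB d))) - m (v (S.label (S.rotW (S.rotB d))))) m1))
        rw [neg_eq_of_add_eq_zero_right hs] at hm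
        exact (Submodule.smul_mem_iff _ (sub_ne_zero.2 (h.separated _))).1 hm

/-- The weights of a vector-relation configuration of the section, up to rescaling. -/
theorem wt_div_wt (h : S.IsDirection l m v u) (R : S.VRC (LinearMap.ker l)) {c : S.White → ℂ}
    (hc : ∀ e, R.vec (S.white e) = c (S.white e) • u e) (hc0 : ∀ s, c s ≠ 0) {e : S.Dart}
    (he : ¬ S.IsLeg e) : R.wt e / R.wt (S.rotB e) =
      (m (v (S.label e)) - m (v (S.label (S.rotW e)))) /
        (m (v (S.label (S.rotB e))) - m (v (S.label e))) *
        (c (S.white (S.rotB e)) / c (S.white e)) := by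
  classical
  have hrel := R.relation e he
  rw [h.trivalent.sum_black he] at hrel
  simp only [hc, smul_smul] at hrel
  have hs := h.sum_eq_zero he
  have n1 := sub_ne_zero.2 (h.separated (S.rotB e))
  have n2 := sub_ne_zero.2 (h.separated (S.rotB (S.rotB e)))
  rw [S.label_rotW_rotB e] at hs n1
  have w1 := R.wt_ne_zero (S.rotB e) (by rwa [BipartiteMap.isLeg_rotB_iff])
  have c0 := hc0 (S.white e)
  generalize m (v (S.label e)) - m (v (S.label (S.rotW e))) = A₀ at hs ⊢
  generalize m (v (S.label (S.rotB e))) - m (v (S.label e)) = A₁ at hs n1 ⊢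
  generalize m (v (S.label (S.rotB (S.rotB e)))) -
    m (v (S.label (S.rotW (S.rotB (S.rotB e))))) = A₂ at hs n2
  -- The relation of `R` and that of the triangle must be proportional: eliminating the third
  -- direction leaves a relation between two independent ones.
  obtain ⟨k0, k1⟩ := h.pair_independent he
    (α := A₂ * (R.wt e * c (S.white e)) -
      (R.wt (S.rotB (S.rotB e)) * c (S.white (S.rotB (S.rotB e)))) * A₀)
    (β := A₂ * (R.wt (S.rotB e) * c (S.white (S.rotB e))) -
      (R.wt (S.rotB (S.rotB e)) * c (S.white (S.rotB (S.rotB e)))) * A₁) (by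
    have e1 := congrArg₂ (fun x y => A₂ • x -
      (R.wt (S.rotB (S.rotB e)) * c (S.white (S.rotB (S.rotB e)))) • y) hrel hs
    simp only [smul_zero, sub_zero] at e1
    rw [← e1]
    module)
  rw [div_mul_div_comm, div_eq_div_iff w1 (mul_ne_zero n1 c0)]
  refine mul_left_cancel₀ n2 ?_
  linear_combination A₁ * k0 - A₀ * k1

open Classical in
/-- The projective cluster variable of the section in terms of an affine coordinate. -/
theorem projVar_eq (h : S.IsDirection l m v u) {t : S.White → Projectivization ℂ (LinearMap.ker l)}
    (ht : ∀ e, t (S.white e) = Projectivization.mk ℂ (u e) (h.ne_zero e))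
    {R : S.VRC (LinearMap.ker l)} (hR : R.IsLiftOf t) {f : S.Face} (hf : ¬ S.IsBoundaryFace f) :
    R.projVar f =
      -((∏ e with S.face e = f, (m (v (S.label e)) - m (v (S.label (S.rotW e))))) /
        ∏ e with S.face e = f, (m (v (S.label e)) - m (v (S.label (S.rotB e))))) := by
  have hex : ∀ s, ∃ a : ℂ, a ≠ 0 ∧ ∀ e, S.white e = s → R.vec s = a • u e := by
    intro s
    induction s using Quotient.inductionOn with
    | h e =>
      have h1 := (hR (S.white e)).trans (ht e)
      rw [Projectivization.mk_eq_mk_iff'] at h1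
      obtain ⟨a, ha⟩ := h1
      refine ⟨a, ?_, fun e' he' => ?_⟩
      · rintro rfl
        exact R.vec_ne_zero _ (by rw [← ha, zero_smul])
      · rw [h.eq_of_white_eq he']
        exact ha.symm
  choose c hc0 hc using hex
  have hfac : ∀ e ∈ Finset.univ.filter fun e => S.face e = f, R.wt e / R.wt (S.rotB e) =
      -1 * ((m (v (S.label e)) - m (v (S.label (S.rotW e)))) /
        (m (v (S.label e)) - m (v (S.label (S.rotB e)))) *
        (c (S.white (S.rotB e)) / c (S.white e))) := by
    intro e he
    have hl : ¬ S.IsLeg e := fun hl => hf ⟨e, hl, (Finset.mem_filter.1 he).2⟩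
    rw [h.wt_div_wt R (fun e => hc _ e rfl) hc0 hl,
      ← neg_sub (m (v (S.label e))) (m (v (S.label (S.rotB e)))), div_neg]
    ring
  -- Consecutive darts of the face share a white vertex, so the rescaling factors cancel around it.
  have hcc : ∏ e with S.face e = f, c (S.white (S.rotB e)) = ∏ e with S.face e = f, c (S.white e) := by
    refine (Finset.prod_equiv S.faceRot (fun e => ?_) fun e _ => ?_).symm
    · simp only [Finset.mem_filter_univ]
      rw [show S.face (S.faceRot e) = S.face e from cycleMk_apply _ _]
    · have h1 : S.rotB (S.faceRot e) = S.rotW⁻¹ e := perm_apply_inv_self _ _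
      rw [h1, ← S.white_rotW (S.rotW⁻¹ e), perm_apply_inv_self]
  rw [BipartiteMap.VRC.projVar, Finset.prod_congr rfl hfac, Finset.prod_mul_distrib,
    Finset.prod_const, Finset.prod_mul_distrib, Finset.prod_div_distrib, Finset.prod_div_distrib,
    hcc, div_self (Finset.prod_ne_zero_iff.2 fun e _ => hc0 _), mul_one, ← mul_assoc, ← pow_add]
  have : (-1 : ℂ) ^ ((Finset.univ.filter fun e => S.face e = f).card + 1 +
      (Finset.univ.filter fun e => S.face e = f).card) = -1 := by
    rw [Odd.neg_one_pow]
    exact ⟨(Finset.univ.filter fun e => S.face e = f).card, by ring⟩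
  rw [this, neg_one_mul]

end IsDirection

/-- The cluster variables of the section agree with those of the affine cluster structure. -/
theorem IsDirection.projVar_eq_affVar {G : BipartiteMap} {S : LabelledMap G.White}
    {l m : V →ₗ[ℂ] ℂ} {v : G.White → V} {u : S.Dart → LinearMap.ker l}
    (h : S.IsDirection l m v u) (hG : G.IsTrivalent) {T : G.White → Projectivization ℂ V}
    (hT : G.IsTCDMap T) (hv : IsAffineLift T l v)
    (hm : ∀ w w', v w ≠ v w' → m (v w) ≠ m (v w'))
    (hq : S.HasDualQuiver G.IsBoundaryWhite fun a b => G.cornerCount a b - G.cornerCount b a)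
    {t : S.White → Projectivization ℂ (LinearMap.ker l)}
    (ht : ∀ e, t (S.white e) = Projectivization.mk ℂ (u e) (h.ne_zero e))
    {R : S.VRC (LinearMap.ker l)} (hR : R.IsLiftOf t) {R' : G.VRC V} (hR' : R'.IsLiftOf T)
    (hH : R'.IsAffineGauge (LinearMap.ker l)) {f : S.Face} (hf : ¬ S.IsBoundaryFace f) :
    R.projVar f = R'.affVar (hq.faceEquiv f) := by
  classical
  have hw : ¬ G.IsBoundaryWhite (hq.faceEquiv f) := by rwa [← hq.isBoundaryFace_iff]
  rw [h.projVar_eq ht hR hf, BipartiteMap.VRC.affVar_eq hG hT hR' hH hv hm hw]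
  simp only [hq.face_eq_iff]
  generalize hq.faceEquiv f = w at hw
  have hSleg : ∀ e, S.label e = w → ¬ S.IsLeg e := fun e he hl => hw ((hq.frozen w).1 ⟨e, hl, he⟩)
  have hGleg : ∀ d, G.white d = w → ¬ G.IsLeg d := fun d hd hl => hw ⟨d, hl, hd⟩
  have hSleg' : ∀ e, S.label (S.rotW e) = w → ¬ S.IsLeg e := by
    intro e he hl
    rw [S.label_rotW] at he
    exact hSleg _ he ((BipartiteMap.isLeg_rotB_inv_iff _ _).2 hl)
  congr 1
  have e1 : ∏ e with S.label e = w, (m (v (S.label e)) - m (v (S.label (S.rotW e)))) =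
      ∏ e with S.label e = w, (m (v w) - m (v (S.label (S.rotW e)))) :=
    Finset.prod_congr rfl fun e he => by rw [(Finset.mem_filter.1 he).2]
  -- Reindexing by `rotB` turns the denominator into a product over the darts with `w` on their
  -- right, i.e. over the arrows out of `w`.
  have e2 : ∏ e with S.label e = w, (m (v (S.label e)) - m (v (S.label (S.rotB e)))) =
      ∏ e with S.label (S.rotW e) = w, (m (v w) - m (v (S.label e))) := by
    refine Finset.prod_equiv S.rotB (fun e => ?_) fun e he => ?_
    · simp only [Finset.mem_filter_univ, S.label_rotW_rotB]
    · rw [(Finset.mem_filter.1 he).2]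
  have e3 : ∏ d with G.white d = w, (m (v w) - m (v (G.white (G.rotB⁻¹ d)))) =
      ∏ d with G.white (G.rotB d) = w, (m (v w) - m (v (G.white d))) := by
    refine (Finset.prod_equiv G.rotB (fun e => ?_) fun e he => ?_).symm
    · simp only [Finset.mem_filter_univ]
    · rw [perm_inv_apply_self]
  rw [e1, e2, e3]
  refine prod_div_prod_eq (g := fun w' => m (v w) - m (v w')) (f := fun e => S.label (S.rotW e))
    (f' := S.label) (k := fun d => G.white (G.rotB d)) (k' := G.white) ?_ ?_ fun w' => ?_
  · intro e he
    obtain rfl := (Finset.mem_filter.1 he).2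
    exact sub_ne_zero.2 (h.separated e).symm
  · intro d hd
    obtain rfl := (Finset.mem_filter.1 hd).2
    have hl : ¬ G.IsLeg d := by
      rw [← G.isLeg_rotB_iff]
      exact hGleg _ rfl
    exact sub_ne_zero.2 (hm _ _ (hv.ne (hT.distinct _ _ hl
      (BipartiteMap.black_eq.2 (BipartiteMap.rotB_sameCycle d)) (hG d hl).1.symm))).symm
  -- As `w` is internal, no leg has it on either side, so the restriction to non-legs in the arrow
  -- counts is harmless.
  · have := hq.arrows w' w
    rw [arrowCount_eq_card, arrowCount_eq_card, BipartiteMap.cornerCount_eq_card,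
      BipartiteMap.cornerCount_eq_card] at this
    simp only [Finset.filter_filter]
    convert this using 5
    · exact ⟨fun h => ⟨hSleg _ h.1, h.2, h.1⟩, fun h => ⟨h.2.2, h.2.1⟩⟩
    · exact ⟨fun h => ⟨hSleg' _ h.1, h.1, h.2⟩, fun h => h.2⟩
    · exact and_comm

end LabelledMap

/-! ### Assembling the theorem -/

theorem exists_ker_eq_of_finrank {d : ℕ} {H : Submodule ℂ (Fin (d + 1) → ℂ)}
    (hH : Module.finrank ℂ H = d) : ∃ l : (Fin (d + 1) → ℂ) →ₗ[ℂ] ℂ, LinearMap.ker l = H := by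
  have hlt : H < ⊤ := by
    refine lt_top_iff_ne_top.2 ?_
    rintro rfl
    rw [finrank_top, Module.finrank_fin_fun] at hH
    omega
  obtain ⟨l, hl, hle⟩ := Submodule.exists_le_ker_of_lt_top H hlt
  refine ⟨l, (Submodule.eq_of_le_of_finrank_eq hle ?_).symm⟩
  have h1 := LinearMap.finrank_range_add_finrank_ker l
  rw [LinearMap.range_eq_top.2 (LinearMap.surjective hl), finrank_top, Module.finrank_self,
    Module.finrank_fin_fun] at h1
  omega

theorem mainTheorem1 (d : ℕ) (hd : 2 ≤ d)
    (G : BipartiteMap) (hG : G.IsBTB) (hmin : G.IsMinimal)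
    (T : G.White → Projectivization ℂ (Fin (d + 1) → ℂ))
    (hT : G.IsTCDMap T) (hT1 : G.IsOneGeneric T)
    (H : Submodule ℂ (Fin (d + 1) → ℂ)) (hH : Module.finrank ℂ H = d)
    (hHT : G.IsGenericHyperplane T H)
    (S : LabelledMap G.White) (hS : G.IsSectionGraph S) :
    ∃ t : S.White → Projectivization ℂ H, S.IsSectionMap T H t ∧ S.IsTCDMap t ∧
      ∃ φ : S.Face ≃ G.White, (∀ x, φ (S.face x) = S.label x) ∧
        (∀ f, S.projQuiver.frozen f ↔ G.affQuiver.frozen (φ f)) ∧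
        (∀ f g, S.projQuiver.arrows f g = G.affQuiver.arrows (φ f) (φ g)) ∧
        (∃ R : S.VRC H, R.IsLiftOf t) ∧
        (∃ R : G.VRC (Fin (d + 1) → ℂ), R.IsLiftOf T ∧ R.IsAffineGauge H) ∧
        ∀ (R : S.VRC H) (R' : G.VRC (Fin (d + 1) → ℂ)),
          R.IsLiftOf t → R'.IsLiftOf T → R'.IsAffineGauge H →
          ∀ f, ¬ S.projQuiver.frozen f → R.projVar f = R'.affVar (φ f) := by
  obtain ⟨l, rfl⟩ := exists_ker_eq_of_finrank hH
  have hl : ∀ w, l (T w).rep ≠ 0 := fun w h0 => hHT w (by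
    rw [Projectivization.submodule_eq, Submodule.span_singleton_le_iff_mem]
    exact h0)
  obtain ⟨v, hv⟩ := exists_isAffineLift hl
  obtain ⟨m, hm⟩ := exists_separating_dual v
  obtain ⟨A, M, h1, h2, h3, hStri⟩ := hS
  have hstar := BipartiteMap.starGraph_compatible hG hmin hT hT1 hv hm
  have hstar' := BipartiteMap.starGraph_separatedUpToLeaves hG.planar hmin hT hT1 hv hm
  obtain ⟨hcomp, hsep⟩ := hstar.sectionGraph hstar' (fun a b c hli heq => by
    have : v a ≠ v b := fun h => absurd (hli.injective (a₁ := 0) (a₂ := 1) h) (by decide)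
    exact hm _ _ this heq) h1 h2 h3 hStri
  obtain ⟨u, hu⟩ := LabelledMap.exists_isDirection hv.eq_one hStri hcomp hsep
  obtain ⟨t, ht⟩ := hu.exists_section
  have hq := hcomp.dualQuiver
  have htTCD := hu.isTCDMap ht
  refine ⟨t, hu.isSectionMap hv ht, htTCD, hq.faceEquiv, hq.faceEquiv_face,
    hq.isBoundaryFace_iff, fun f g => ?_, ?_, hT.exists_vrc hG.trivalent hl,
    fun R R' hR hR' hH' f hf => hu.projVar_eq_affVar hG.trivalent hT hv hm hq ht hR hR' hH' hf⟩
  -- Deletion of 2-cycles is truncated subtraction, so it is determined by the signed arrow counts.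
  · have e1 := hq.card_arrows f g
    have e2 := hq.card_arrows g f
    have e3 := BipartiteMap.card_affArrows (hq.faceEquiv f) (hq.faceEquiv g)
    have e4 := BipartiteMap.card_affArrows (hq.faceEquiv g) (hq.faceEquiv f)
    have e5 := hq.arrows (hq.faceEquiv f) (hq.faceEquiv g)
    simp only [BipartiteMap.projQuiver, BipartiteMap.affQuiver, IceQuiver.ofArrows]
    omega
  -- Any linear form on `H` that vanishes at no point of the section can take the place of `l`; the
  -- gauge itself is irrelevant here.
  · obtain ⟨l', hl'⟩ := Module.exists_dual_forall_apply_ne_zero (K := ℂ)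
      (fun s => (t s).rep) (fun s => (t s).rep_nonzero)
    obtain ⟨R, hR, -⟩ := htTCD.exists_vrc hStri hl'
    exact ⟨R, hR⟩
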